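/- Let $\mathfrak t^*(\mathbb Z)$ be a free abelian group of rank $n\ge 1$, put $\mathfrak t^*(R)=\mathfrak t^*(\mathbb Z)\otimes_{\mathbb Z}R$, and let $\mathfrak t(\mathbb F_2)$ be the dual space of $\mathfrak t^*(\mathbb F_2)$. A *primitive complex* $K$ in $\mathfrak t^*(\mathbb R)$ is a finite simplicial complex affinely embedded in $\mathfrak t^*(\mathbb R)$, with vertices in $\mathfrak t^*(\mathbb Z)$, purely of dimension $n$, whose $n$-simplices have the minimal volume $1/n!$ (a parallelepiped on a basis of $\mathfrak t^*(\mathbb Z)$ having volume $1$). Its boundary $\partial K$ is the subcomplex made of the $(n-1)$-simplices contained in exactly one $n$-simplex, and of their faces. For a simplex $\sigma$ of $K$ let $T\sigma(\mathbb F_2)\subseteq\mathfrak t^*(\mathbb F_2)$ be the reduction modulo $2$ of the lattice of integral vectors tangent to $\sigma$. The normal cosheaf $N$ and the cotangent cosheaf $T^*$ of $K$ are $N(\sigma)=T\sigma(\mathbb F_2)^{\perp}\subseteq\mathfrak t(\mathbb F_2)$, with the inclusions as extension maps, and $T^*(\sigma)=T\sigma(\mathbb F_2)^*$, with the restrictions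 of linear forms as extension maps; they fit in an exact sequence of cosheaves $0\to N\to\mathfrak t(\mathbb F_2)\to T^*\to 0$, where $\mathfrak t(\mathbb F_2)$ stands for the constant cosheaf. For a sign distribution $\varepsilon\in C^0(K;\mathbb F_2)$ and an $n$-simplex $\sigma$, let $\mathrm D\varepsilon_\sigma\in T^*(\sigma)$ be the only vector such that $\mathrm D\varepsilon_\sigma(\beta-\alpha)=\varepsilon(\beta)-\varepsilon(\alpha)$ for all vertices $\alpha,\beta$ of $\sigma$. The *first derivative* of $\varepsilon$ is the class $\mathrm D\varepsilon\in H_n(K,\partial K;T^*)$ of the relative cycle $\sum_{\sigma}\mathrm D\varepsilon_\sigma\otimes\sigma$. The *second derivative* of $\varepsilon$ is $\mathrm D^2\varepsilon=\partial(\mathrm D\varepsilon)\in H_{n-1}(K,\partial K;N)$, where $\partial:H_n(K,\partial K;T^*)\to H_{n-1}(K,\partial K;N)$ is the connecting morphism of the above exact sequence of cosheaves. A *shelling* of $K$ is a numbering $\sigma_0,\dots,\sigma_k$ (with $k\ge 0$) of its maximal simplices such that, for every $1\le i\le k$, the intersection of $\sigma_i$ with $\bigcup_{j<i}\sigma_j$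 is a non-empty union of faces of codimension $1$ of $\sigma_i$; $K$ is *shellable* if it has a shelling. **Lemma.** If the primitive complex $K$ is shellable, then both $\mathrm D$ and $\mathrm D^2$ are surjective, and the sequences $$0\longrightarrow\mathbb F_2\longrightarrow C^0(K;\mathbb F_2)\overset{\mathrm D}{\longrightarrow}H_n(K,\partial K;T^*)\longrightarrow 0$$ and $$0\longrightarrow\mathrm{Aff}(\mathfrak t^*(\mathbb F_2))\longrightarrow C^0(K;\mathbb F_2)\overset{\mathrm D^2}{\longrightarrow}H_{n-1}(K,\partial K;N)\longrightarrow 0$$ are exact, where $\mathbb F_2\to C^0(K;\mathbb F_2)$ is the inclusion of the constants, $\mathrm{Aff}(\mathfrak t^*(\mathbb F_2))$ is the space of affine functions $\mathfrak t^*(\mathbb F_2)\to\mathbb F_2$, and $\mathrm{Aff}(\mathfrak t^*(\mathbb F_2))\to C^0(K;\mathbb F_2)$ is the evaluation at the vertices of $K$ reduced modulo $2$. -/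

import Mathlib

universe u

namespace TropicalShelling

open scoped TensorProduct
open CategoryTheory MeasureTheory Module

/-! ## Cellular cosheaves on a simplicial complex, relative homology, shellings -/

section Complexes
variable {ι : Type u}

/-- The (nonempty) simplices of a simplicial complex, ordered by inclusion. -/
abbrev Face (X : PreAbstractSimplicialComplex ι) : Type u := {s : Finset ι // s ∈ X.faces}

/-- A cellular cosheaf of `𝔽₂`-vector spaces: a contravariant functor on the poset of simplices. -/
abbrev Cosheaf (X : PreAbstractSimplicialComplex ι) : Type (u + 1) :=
  (Face X)ᵒᵖ ⥤ ModuleCat.{u} (ZMod 2)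

/-- A shelling of a pure complex: a numbering `σ 0, …, σ k` of the maximal simplices such that, for every
`i > 0`, the intersection of (the closed simplex) `σ i` with the union of the previous ones is a
nonempty union of codimension one faces of `σ i`; `G` is the set of these faces. -/
def IsShelling (X : PreAbstractSimplicialComplex ι) {k : ℕ} (σ : Fin (k + 1) → Finset ι) : Prop :=
  Function.Injective σ ∧ Set.range σ = {s | Maximal (· ∈ X.faces) s} ∧
    ∀ i, i ≠ 0 → ∃ G : Set (Finset ι), G.Nonempty ∧
      (∀ ρ ∈ G, ρ ⊆ σ i ∧ ρ.card + 1 = (σ i).card) ∧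
      ∀ τ : Finset ι, τ.Nonempty →
        ((τ ⊆ σ i ∧ ∃ j < i, τ ⊆ σ j) ↔ ∃ ρ ∈ G, τ ⊆ ρ)

/-- A complex is shellable if it admits a shelling. In particular it is not empty. -/
def IsShellable (X : PreAbstractSimplicialComplex ι) : Prop :=
  ∃ (k : ℕ) (σ : Fin (k + 1) → Finset ι), IsShelling X σ

variable {X : PreAbstractSimplicialComplex ι} [Finite (Face X)]
variable (L : LowerSet (Face X))

/-- The `k`-simplices of `X` that do not belong to the subcomplex `L`. -/
abbrev Cell (k : ℕ) : Type u := {σ : Face X // σ.1.card = k + 1 ∧ σ ∉ L}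

noncomputable instance (k : ℕ) : Fintype (Cell L k) := Fintype.ofFinite _

noncomputable instance (i : ℕ) (σ : Face X) : Fintype {τ : Cell L i // σ ≤ τ.1} := Fintype.ofFinite _

variable (F : Cosheaf X)

/-- The relative chains `C_k(X, L; F) = C_k(X; F) / C_k(L; F) = ⨁ F(σ)`, the sum being over the
`k`-simplices `σ` of `X` that are not in `L` (there are finitely many). -/
abbrev RelChain (k : ℕ) : Type u := ∀ σ : Cell L k, F.obj (Opposite.op σ.1)

/-- The boundary operator `v ⊗ τ ↦ ∑_{σ ≤ τ} v|_σ ⊗ σ` on relative chains, from degree `i` to degree `j`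
(used for `i = j + 1`), written coefficientwise. -/
noncomputable def relBoundary (i j : ℕ) : RelChain L F i →ₗ[ZMod 2] RelChain L F j :=
  LinearMap.pi fun σ => ∑ τ : {τ : Cell L i // σ.1 ≤ τ.1},
    (F.map (homOfLE τ.2).op).hom ∘ₗ LinearMap.proj τ.1

lemma relBoundary_apply (i j : ℕ) (c : RelChain L F i) (σ : Cell L j) :
    relBoundary L F i j c σ = ∑ τ : {τ : Cell L i // σ.1 ≤ τ.1},
      (F.map (homOfLE τ.2).op).hom (c τ.1) := by
  simp [relBoundary]

lemma relBoundary_relBoundary (k : ℕ) (c : RelChain L F (k + 2)) :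
    relBoundary L F (k + 1) k (relBoundary L F (k + 2) (k + 1) c) = 0 := by
  classical
  funext σ
  let term : (Σ τ : {τ : Cell L (k + 1) // σ.1 ≤ τ.1}, {υ : Cell L (k + 2) // τ.1.1 ≤ υ.1}) →
      F.obj (Opposite.op σ.1) :=
    fun x => (F.map (homOfLE (x.1.2.trans x.2.2)).op).hom (c x.2.1)
  have hsum : relBoundary L F (k + 1) k (relBoundary L F (k + 2) (k + 1) c) σ = ∑ x, term x := by
    rw [relBoundary_apply, Fintype.sum_sigma]
    refine Finset.sum_congr rfl fun τ _ => ?_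
    rw [relBoundary_apply, map_sum]
    refine Finset.sum_congr rfl fun υ _ => ?_
    change (F.map (homOfLE υ.2).op ≫ F.map (homOfLE τ.2).op).hom (c υ.1) = _
    rw [← F.map_comp]
    rfl
  rw [hsum]
  have hcard : ∀ x : (Σ τ : {τ : Cell L (k + 1) // σ.1 ≤ τ.1}, {υ : Cell L (k + 2) // τ.1.1 ≤ υ.1}),
      (x.2.1.1.1 \ x.1.1.1.1).card = 1 := fun x => by
    rw [Finset.card_sdiff_of_subset x.2.2, x.1.1.2.1, x.2.1.2.1]; omega
  have hle : ∀ x : (Σ τ : {τ : Cell L (k + 1) // σ.1 ≤ τ.1}, {υ : Cell L (k + 2) // τ.1.1 ≤ υ.1}),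
      σ.1.1 ∪ (x.2.1.1.1 \ x.1.1.1.1) ⊆ x.2.1.1.1 := fun x =>
    Finset.union_subset (x.1.2.trans x.2.2 : σ.1 ≤ x.2.1.1) Finset.sdiff_subset
  let flip : ∀ x : (Σ τ : {τ : Cell L (k + 1) // σ.1 ≤ τ.1}, {υ : Cell L (k + 2) // τ.1.1 ≤ υ.1}),
      {τ : Cell L (k + 1) // σ.1 ≤ τ.1} := fun x =>
    ⟨⟨⟨σ.1.1 ∪ (x.2.1.1.1 \ x.1.1.1.1),
        (X.isRelLowerSet_faces x.2.1.1.2).2 (hle x)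
          ((X.isRelLowerSet_faces σ.1.2).1.mono Finset.subset_union_left)⟩,
      by
        rw [Finset.card_union_of_disjoint, hcard x, σ.2.1]
        exact Finset.disjoint_left.2 fun a ha hb => (Finset.mem_sdiff.1 hb).2 (x.1.2 ha),
      fun hL => σ.2.2 (L.lower (show σ.1.1 ⊆ _ from Finset.subset_union_left) hL)⟩,
      (show σ.1.1 ⊆ _ from Finset.subset_union_left)⟩
  refine Finset.sum_involution (fun x _ => ⟨flip x, ⟨x.2.1, hle x⟩⟩) ?_ ?_ ?_ ?_
  · intro x _
    exact ZModModule.add_self (term x)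
  · intro x _ _ h
    obtain ⟨a, ha⟩ := Finset.card_pos.1 (by rw [hcard x]; exact one_pos)
    have h' : σ.1.1 ∪ (x.2.1.1.1 \ x.1.1.1.1) = x.1.1.1.1 :=
      congrArg (fun y : (Σ τ : {τ : Cell L (k + 1) // σ.1 ≤ τ.1},
        {υ : Cell L (k + 2) // τ.1.1 ≤ υ.1}) => y.1.1.1.1) h
    exact (Finset.mem_sdiff.1 ha).2 (h' ▸ Finset.mem_union_right _ ha)
  · intro x _
    exact Finset.mem_univ _
  · rintro ⟨⟨τ, hτ⟩, ⟨υ, hυ⟩⟩ _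
    have key : flip ⟨flip ⟨⟨τ, hτ⟩, ⟨υ, hυ⟩⟩, ⟨υ, hle ⟨⟨τ, hτ⟩, ⟨υ, hυ⟩⟩⟩⟩ = ⟨τ, hτ⟩ := by
      apply Subtype.ext; apply Subtype.ext; apply Subtype.ext
      change σ.1.1 ∪ (υ.1.1 \ (σ.1.1 ∪ (υ.1.1 \ τ.1.1))) = τ.1.1
      have h1 : σ.1.1 ⊆ τ.1.1 := hτ
      have h2 : τ.1.1 ⊆ υ.1.1 := hυ
      ext a
      have := @h1 a
      have := @h2 a
      simp only [Finset.mem_union, Finset.mem_sdiff]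
      tauto
    have sig : ∀ (t t' : {τ : Cell L (k + 1) // σ.1 ≤ τ.1}) (_ : t = t') (p : t.1.1 ≤ υ.1)
        (q : t'.1.1 ≤ υ.1), (⟨t, ⟨υ, p⟩⟩ : (Σ τ : {τ : Cell L (k + 1) // σ.1 ≤ τ.1},
          {υ : Cell L (k + 2) // τ.1.1 ≤ υ.1})) = ⟨t', ⟨υ, q⟩⟩ := by
      rintro t _ rfl p q
      rfl
    exact sig _ _ key _ _

/-- The chain complex `C_•(X, L; F)`. -/
noncomputable def relComplex : ChainComplex (ModuleCat.{u} (ZMod 2)) ℕ where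
  X k := ModuleCat.of (ZMod 2) (RelChain L F k)
  d i j := if j + 1 = i then ModuleCat.ofHom (relBoundary L F i j) else 0
  shape i j h := if_neg h
  d_comp_d' i j k h h' := by
    obtain rfl : j + 1 = i := h
    obtain rfl : k + 1 = j := h'
    rw [if_pos rfl, if_pos rfl]
    ext c : 2
    exact relBoundary_relBoundary L F k c

lemma relComplex_d (i j : ℕ) (h : j + 1 = i) :
    (relComplex L F).d i j = ModuleCat.ofHom (relBoundary L F i j) := if_pos h

/-- The relative homology `H_k(X, L; F)`. -/
noncomputable abbrev relHomology (k : ℕ) : ModuleCat.{u} (ZMod 2) := (relComplex L F).homology k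

variable {F} {G : Cosheaf X}

/-- The chain map induced by a morphism of cosheaves. -/
noncomputable def relComplexMap (η : F ⟶ G) : relComplex L F ⟶ relComplex L G where
  f k := ModuleCat.ofHom (LinearMap.pi fun σ => (η.app (Opposite.op σ.1)).hom ∘ₗ LinearMap.proj σ)
  comm' i j h := by
    obtain rfl : j + 1 = i := h
    rw [relComplex_d _ _ _ _ rfl, relComplex_d _ _ _ _ rfl]
    ext c : 2
    funext σ
    change relBoundary L G (j + 1) j (fun σ => (η.app (Opposite.op σ.1)).hom (c σ)) σ =
      (η.app (Opposite.op σ.1)).hom (relBoundary L F (j + 1) j c σ)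
    refine (relBoundary_apply L G _ _ _ _).trans (Eq.trans ?_ (congrArg _ (relBoundary_apply L F _ _ _ _)).symm)
    refine Eq.trans ?_ (map_sum (η.app (Opposite.op σ.1)).hom _ _).symm
    refine Finset.sum_congr rfl fun τ _ => ?_
    exact (congrArg (fun f => f.hom (c τ.1)) (η.naturality (homOfLE τ.2).op)).symm

lemma relComplexMap_comp {H : Cosheaf X} (η : F ⟶ G) (θ : G ⟶ H) (h : η ≫ θ = 0) :
    relComplexMap L η ≫ relComplexMap L θ = 0 := by
  ext k c : 3
  funext σ
  exact congrArg (fun f => (f.app (Opposite.op σ.1)).hom (c σ)) h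

/-- The short complex of relative chain complexes given by two composable morphisms of cosheaves. -/
noncomputable abbrev relShortComplex {H : Cosheaf X} (η : F ⟶ G) (θ : G ⟶ H) (h : η ≫ θ = 0) :
    ShortComplex (ChainComplex (ModuleCat.{u} (ZMod 2)) ℕ) :=
  ShortComplex.mk (relComplexMap L η) (relComplexMap L θ) (relComplexMap_comp L η θ h)

lemma relShortComplex_shortExact {H : Cosheaf X} (η : F ⟶ G) (θ : G ⟶ H) (h : η ≫ θ = 0)
    (hη : ∀ σ, Function.Injective (η.app σ).hom) (hθ : ∀ σ, Function.Surjective (θ.app σ).hom)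
    (hex : ∀ σ, Function.Exact (η.app σ).hom (θ.app σ).hom) :
    (relShortComplex L η θ h).ShortExact := by
  apply HomologicalComplex.shortExact_of_degreewise_shortExact
  intro k
  refine ShortComplex.ShortExact.mk' ?_ ?_ ?_
  · rw [ShortComplex.moduleCat_exact_iff]
    intro x hx
    have hx' : ∀ σ : Cell L k, ∃ y, (η.app (Opposite.op σ.1)).hom y = x σ := fun σ =>
      (hex _ _).1 (congrFun hx σ)
    choose y hy using hx'
    exact ⟨y, funext hy⟩
  · rw [ModuleCat.mono_iff_injective]
    intro x y hxy
    funext σ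
    exact hη _ (congrFun hxy σ)
  · rw [ModuleCat.epi_iff_surjective]
    intro x
    choose y hy using fun σ : Cell L k => hθ (Opposite.op σ.1) (x σ)
    exact ⟨y, funext hy⟩



section Tangent
variable {V : Type u} [AddCommGroup V] [Module (ZMod 2) V] (T : Face X → Submodule (ZMod 2) V)
  (hT : Monotone T)

/-- For subspaces `T σ` of `V`, increasing in `σ`: the cosheaf `σ ↦ (T σ)^⊥ ⊆ V^*`, with inclusions. -/
noncomputable def annihilatorCosheaf : Cosheaf X where
  obj σ := ModuleCat.of (ZMod 2) (T σ.unop).dualAnnihilator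
  map f := ModuleCat.ofHom
    (Submodule.inclusion (Submodule.dualAnnihilator_anti (hT (leOfHom f.unop))))
  map_id _ := ModuleCat.hom_ext (LinearMap.ext fun _ => rfl)
  map_comp _ _ := ModuleCat.hom_ext (LinearMap.ext fun _ => rfl)

/-- For subspaces `T σ` of `V`, increasing in `σ`: the cosheaf `σ ↦ (T σ)^*`, with the quotient maps
(restriction of linear forms). -/
noncomputable def dualCosheaf : Cosheaf X where
  obj σ := ModuleCat.of (ZMod 2) (Dual (ZMod 2) (T σ.unop))
  map f := ModuleCat.ofHom (Submodule.inclusion (hT (leOfHom f.unop))).dualMap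
  map_id _ := ModuleCat.hom_ext (LinearMap.ext fun _ => rfl)
  map_comp _ _ := ModuleCat.hom_ext (LinearMap.ext fun _ => rfl)

variable (X V) in
/-- The constant cosheaf with value `V^*`. -/
noncomputable def constantCosheaf : Cosheaf X :=
  (Functor.const _).obj (ModuleCat.of (ZMod 2) (Dual (ZMod 2) V))

noncomputable def annihilatorInclusion : annihilatorCosheaf T hT ⟶ constantCosheaf X V where
  app σ := ModuleCat.ofHom (T σ.unop).dualAnnihilator.subtype
  naturality _ _ _ := ModuleCat.hom_ext (LinearMap.ext fun _ => rfl)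

noncomputable def restrictionToDual : constantCosheaf X V ⟶ dualCosheaf T hT where
  app σ := ModuleCat.ofHom (T σ.unop).dualRestrict
  naturality _ _ _ := ModuleCat.hom_ext (LinearMap.ext fun _ => rfl)

lemma annihilatorInclusion_comp : annihilatorInclusion T hT ≫ restrictionToDual T hT = 0 := by
  apply NatTrans.ext
  funext σ
  refine ModuleCat.hom_ext (LinearMap.ext fun v => LinearMap.ext fun w => ?_)
  exact (Submodule.mem_dualAnnihilator _).1 v.2 w.1 w.2

lemma exact_annihilator (W : Submodule (ZMod 2) V) :
    Function.Exact W.dualAnnihilator.subtype W.dualRestrict := by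
  intro v
  rw [← LinearMap.mem_ker, W.dualRestrict_ker_eq_dualAnnihilator]
  simp

lemma annihilatorSequence_shortExact (L : LowerSet (Face X)) :
    (relShortComplex L (annihilatorInclusion T hT) (restrictionToDual T hT)
      (annihilatorInclusion_comp T hT)).ShortExact := by
  apply relShortComplex_shortExact
  · intro σ; exact Subtype.val_injective
  · intro σ; exact Subspace.dualRestrict_surjective
  · intro σ; exact exact_annihilator (T σ.unop)

end Tangent
end Complexes

/-! ## Primitive complexes in `t^*(ℝ)`

The lattice `t^*(ℤ)` is a free abelian group `Λ` of finite rank `n = finrank ℤ Λ`. -/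

section Lattice
variable (Λ : Type u) [AddCommGroup Λ]

/-- The real vector space `t^*(ℝ)`. -/
abbrev RealSpace : Type u := ℝ ⊗[ℤ] Λ
/-- The `𝔽₂`-vector space `t^*(𝔽₂)`. Its dual space is `t(𝔽₂)`. -/
def ModTwo : Type u := ZMod 2 ⊗[ℤ] Λ

noncomputable instance : AddCommGroup (ModTwo Λ) := inferInstanceAs (AddCommGroup (ZMod 2 ⊗[ℤ] Λ))

noncomputable instance : Module (ZMod 2) (ModTwo Λ) :=
  inferInstanceAs (Module (ZMod 2) (ZMod 2 ⊗[ℤ] Λ))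

/-- `ModTwo Λ` is by definition the tensor product. -/
noncomputable def modTwoEquiv : ModTwo Λ ≃ₗ[ZMod 2] ZMod 2 ⊗[ℤ] Λ := LinearEquiv.refl _ _


variable {Λ}
/-- The inclusion of the lattice `t^*(ℤ) → t^*(ℝ)`. -/
noncomputable def toReal : Λ →ₗ[ℤ] RealSpace Λ := TensorProduct.mk ℤ ℝ Λ 1
/-- Reduction modulo two `t^*(ℤ) → t^*(𝔽₂)`. -/
noncomputable def red : Λ →+ ModTwo Λ where
  toFun x := (modTwoEquiv Λ).symm ((1 : ZMod 2) ⊗ₜ[ℤ] x)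
  map_zero' := by simp
  map_add' x y := by rw [TensorProduct.tmul_add, map_add]

/-- The Lebesgue measure on `t^*(ℝ)`, normalised by the lattice: it is computed in the coordinates of a
basis of `t^*(ℤ)` (two such bases differ by a matrix of determinant `±1`). -/
noncomputable def latticeVolume [Module.Free ℤ Λ] [Module.Finite ℤ Λ]
    (S : Set (RealSpace Λ)) : ENNReal :=
  volume (((Module.finBasis ℤ Λ).baseChange ℝ).equivFun '' S)

lemma toReal_apply (x : Λ) : toReal x = (1 : ℝ) ⊗ₜ[ℤ] x := rfl

lemma toReal_injective [Module.Free ℤ Λ] [Module.Finite ℤ Λ] : Function.Injective (toReal (Λ := Λ)) := by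
  intro x y h
  apply (Module.finBasis ℤ Λ).ext_elem
  intro i
  have := congrArg (fun z => ((Module.finBasis ℤ Λ).baseChange ℝ).repr z i) h
  simpa [toReal_apply] using this

lemma mem_convexHull_toReal [Module.Free ℤ Λ] [Module.Finite ℤ Λ] (s : Finset Λ) (x : RealSpace Λ) :
    x ∈ convexHull ℝ (toReal '' (s : Set Λ)) ↔
      ∃ w : Λ → ℝ, (∀ b ∈ s, 0 ≤ w b) ∧ ∑ b ∈ s, w b = 1 ∧ ∑ b ∈ s, w b • toReal b = x := by
  classical
  rw [← Finset.coe_image, Finset.mem_convexHull']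
  have hinj : Set.InjOn (toReal (Λ := Λ)) (s : Set Λ) := toReal_injective.injOn
  constructor
  · rintro ⟨w, h0, h1, h2⟩
    rw [Finset.sum_image hinj] at h1 h2
    exact ⟨fun b => w (toReal b), fun b hb => h0 _ (Finset.mem_image_of_mem _ hb), h1, h2⟩
  · rintro ⟨w, h0, h1, h2⟩
    have hl : ∀ b, Function.invFun (toReal (Λ := Λ)) (toReal b) = b :=
      Function.leftInverse_invFun toReal_injective
    refine ⟨fun y => w (Function.invFun toReal y), ?_, ?_, ?_⟩
    · intro y hy
      obtain ⟨b, hb, rfl⟩ := Finset.mem_image.1 hy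
      simpa [hl] using h0 b hb
    · rw [Finset.sum_image hinj]; simpa [hl] using h1
    · rw [Finset.sum_image hinj]; simpa [hl] using h2

lemma volume_corner (n : ℕ) (r : ℝ) (hr : 0 ≤ r) :
    volume {x : Fin n → ℝ | (∀ i, 0 ≤ x i) ∧ ∑ i, x i ≤ r} =
      ENNReal.ofReal (r ^ n / n.factorial) := by
  induction n generalizing r with
  | zero => 
    have : {x : Fin 0 → ℝ | (∀ i, 0 ≤ x i) ∧ ∑ i, x i ≤ r} = Set.univ := by
      ext x; simp [hr]
    rw [this, volume_pi, Measure.pi_of_empty (x := 0)]; simp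
  | succ n ih =>
    have hmeas : MeasurableSet {p : ℝ × (Fin n → ℝ) |
        0 ≤ p.1 ∧ (∀ i, 0 ≤ p.2 i) ∧ p.1 + ∑ i, p.2 i ≤ r} := by
      apply IsClosed.measurableSet
      simp only [Set.ofPred_and, Set.ofPred_forall]
      refine (isClosed_le continuous_const (by fun_prop)).inter
        ((isClosed_iInter fun i => isClosed_le continuous_const (by fun_prop)).inter
          (isClosed_le (by fun_prop) continuous_const))
    have hpre : {x : Fin (n+1) → ℝ | (∀ i, 0 ≤ x i) ∧ ∑ i, x i ≤ r} =
        (MeasurableEquiv.piFinSuccAbove (fun _ => ℝ) 0) ⁻¹' {p : ℝ × (Fin n → ℝ) |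
        0 ≤ p.1 ∧ (∀ i, 0 ≤ p.2 i) ∧ p.1 + ∑ i, p.2 i ≤ r} := by
      ext x
      simp [MeasurableEquiv.piFinSuccAbove, Fin.forall_fin_succ, Fin.sum_univ_succ, Fin.tail, and_assoc]
    rw [hpre, (volume_preserving_piFinSuccAbove (fun _ => ℝ) 0).measure_preimage
      hmeas.nullMeasurableSet, Measure.volume_eq_prod, Measure.prod_apply hmeas]
    have hslice : ∀ t : ℝ, volume (Prod.mk t ⁻¹' {p : ℝ × (Fin n → ℝ) |
        0 ≤ p.1 ∧ (∀ i, 0 ≤ p.2 i) ∧ p.1 + ∑ i, p.2 i ≤ r}) =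
        (Set.Icc 0 r).indicator (fun t => ENNReal.ofReal ((r - t) ^ n / n.factorial)) t := by
      intro t
      by_cases ht : t ∈ Set.Icc 0 r
      · rw [Set.indicator_of_mem ht, ← ih (r - t) (by linarith [ht.2])]
        congr 1
        ext y
        simp only [Set.mem_preimage, Set.mem_ofPred_eq]
        constructor
        · rintro ⟨-, h, h'⟩; exact ⟨h, by linarith⟩
        · rintro ⟨h, h'⟩; exact ⟨ht.1, h, by linarith⟩
      · rw [Set.indicator_of_notMem ht]
        convert measure_empty
        · ext y
          simp only [Set.mem_preimage, Set.mem_ofPred_eq, Set.mem_empty_iff_false, iff_false]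
          rintro ⟨h0, h, h'⟩
          exact ht ⟨h0, by linarith [Finset.sum_nonneg fun i (_ : i ∈ Finset.univ) => h i]⟩
        · infer_instance
    simp_rw [hslice]
    rw [lintegral_indicator measurableSet_Icc, ← ofReal_integral_eq_lintegral_ofReal]
    · congr 1
      rw [integral_Icc_eq_integral_Ioc, ← intervalIntegral.integral_of_le hr]
      rw [intervalIntegral.integral_comp_sub_left (fun t => t ^ n / (n.factorial : ℝ)) r]
      rw [intervalIntegral.integral_div, integral_pow]
      simp [Nat.factorial_succ]
      field_simp
    · exact (Continuous.continuousOn (by fun_prop)).integrableOn_compact isCompact_Icc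
    · filter_upwards [ae_restrict_mem measurableSet_Icc] with t ht
      have : 0 ≤ r - t := by linarith [ht.2]
      positivity


variable [Module.Free ℤ Λ] [Module.Finite ℤ Λ]

/-- An integral `n`-simplex is primitive if it has the minimal volume `1 / n!`. -/
def IsPrimitiveSimplex (s : Finset Λ) : Prop :=
  s.card = finrank ℤ Λ + 1 ∧
    latticeVolume (convexHull ℝ (toReal '' (s : Set Λ))) = ((finrank ℤ Λ).factorial : ENNReal)⁻¹

lemma IsPrimitiveSimplex.exists_basis {s : Finset Λ} (hs : IsPrimitiveSimplex s) {a : Λ}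
    (ha : a ∈ s) : ∃ B : Basis {b // b ∈ s ∧ b ≠ a} ℤ Λ, ∀ b, B b = b.1 - a := by
  classical
  obtain ⟨hcard, hvol⟩ := hs
  let _ : Fintype {b // b ∈ s ∧ b ≠ a} := Fintype.subtype (s.erase a) (by simp [and_comm])
  have hc : Fintype.card {b // b ∈ s ∧ b ≠ a} = finrank ℤ Λ := by
    rw [Fintype.card_of_subtype (s.erase a) (by simp [and_comm]),
      Finset.card_erase_of_mem ha, hcard]; rfl
  let e : Fin (finrank ℤ Λ) ≃ {b // b ∈ s ∧ b ≠ a} := (Fintype.equivFinOfCardEq hc).symm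
  let bas := Module.finBasis ℤ Λ
  let v : Fin (finrank ℤ Λ) → Λ := fun j => (e j).1 - a
  let A : Matrix (Fin (finrank ℤ Λ)) (Fin (finrank ℤ Λ)) ℝ := (bas.toMatrix v).map Int.cast
  have hφ : ∀ x : Λ, (bas.baseChange ℝ).equivFun (toReal x) = fun i => (bas.repr x i : ℝ) := by
    intro x; ext i
    simp [toReal_apply]
  have himg : (bas.baseChange ℝ).equivFun '' (convexHull ℝ (toReal '' (s : Set Λ))) =
      (fun x => (bas.baseChange ℝ).equivFun (toReal a) + x) '' (Matrix.toLin' A ''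
        {x : Fin (finrank ℤ Λ) → ℝ | (∀ i, 0 ≤ x i) ∧ ∑ i, x i ≤ 1}) := by
    have hsum : ∀ {M : Type u} [AddCommMonoid M] (f : Λ → M), ∑ b ∈ s, f b = f a + ∑ j, f (e j) := by
      intro M _ f
      rw [← Finset.add_sum_erase _ _ ha]
      congr 1
      rw [e.sum_comp (fun b : {b // b ∈ s ∧ b ≠ a} => f b)]
      rw [Finset.sum_subtype (s.erase a) (p := fun b => b ∈ s ∧ b ≠ a) (by intro x; simp [and_comm])]
    have hsumR : ∀ (f : Λ → ℝ), ∑ b ∈ s, f b = f a + ∑ j, f (e j) := by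
      intro f
      rw [← Finset.add_sum_erase _ _ ha]
      congr 1
      rw [e.sum_comp (fun b : {b // b ∈ s ∧ b ≠ a} => f b)]
      rw [Finset.sum_subtype (s.erase a) (p := fun b => b ∈ s ∧ b ≠ a) (by intro x; simp [and_comm])]
    have key : ∀ w : Λ → ℝ, ∑ b ∈ s, w b = 1 →
        (bas.baseChange ℝ).equivFun (∑ b ∈ s, w b • toReal b) =
          (bas.baseChange ℝ).equivFun (toReal a) + Matrix.toLin' A (fun j => w (e j)) := by
      intro w hw
      rw [hsumR] at hw
      rw [hsum, map_add, map_sum]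
      simp only [map_smul, hφ]
      ext i
      simp only [Pi.add_apply, Pi.smul_apply, Finset.sum_apply, smul_eq_mul, Matrix.toLin'_apply,
        Matrix.mulVec, dotProduct, A, Matrix.map_apply, Basis.toMatrix_apply, v, map_sub,
        Finsupp.sub_apply, Int.cast_sub, sub_mul, Finset.sum_sub_distrib]
      rw [← Finset.mul_sum]
      have : w a = 1 - ∑ j, w (e j) := by linarith
      rw [this]
      simp only [mul_comm]
      ring
    ext y
    simp only [Set.mem_image, mem_convexHull_toReal]
    constructor
    · rintro ⟨x, ⟨w, h0, h1, rfl⟩, rfl⟩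
      refine ⟨_, ⟨fun j => w (e j), ⟨fun j => h0 _ (e j).2.1, ?_⟩, rfl⟩, (key w h1).symm⟩
      rw [hsumR] at h1
      have := h0 a ha
      linarith
    · rintro ⟨_, ⟨t, ⟨h0, h1⟩, rfl⟩, rfl⟩
      let w : Λ → ℝ := fun b => if h : b ∈ s ∧ b ≠ a then t (e.symm ⟨b, h⟩) else 1 - ∑ j, t j
      have hwa : w a = 1 - ∑ j, t j := by simp [w]
      have hwe : ∀ j, w (e j) = t j := by
        intro j
        have := (e j).2
        simp only [w, dif_pos this]
        simp
      have hw1 : ∑ b ∈ s, w b = 1 := by rw [hsumR, hwa]; simp [hwe]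
      refine ⟨_, ⟨w, ?_, hw1, rfl⟩, ?_⟩
      · intro b hb
        by_cases h : b = a
        · subst h; rw [hwa]; linarith
        · simp only [w, dif_pos (⟨hb, h⟩ : b ∈ s ∧ b ≠ a)]; exact h0 _
      · rw [key w hw1]; simp [hwe]
  have hdetA : A.det = ((bas.det v : ℤ) : ℝ) := by
    rw [Basis.det_apply]
    exact (Int.cast_det _).symm
  rw [latticeVolume, himg, Set.image_add_left, measure_preimage_add,
    Measure.addHaar_image_linearMap, volume_corner _ 1 zero_le_one, LinearMap.det_toLin', hdetA,
    ← ENNReal.ofReal_mul (abs_nonneg _)] at hvol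
  have hunit : IsUnit (bas.det v) := by
    rw [Int.isUnit_iff_abs_eq]
    have hf : (0 : ℝ) < ((finrank ℤ Λ).factorial : ℝ) := by positivity
    rw [← ENNReal.ofReal_natCast, ← ENNReal.ofReal_inv_of_pos hf,
      ENNReal.ofReal_eq_ofReal_iff (by positivity) (by positivity)] at hvol
    field_simp at hvol
    simp at hvol
    exact_mod_cast hvol
  obtain ⟨hli, hsp⟩ := (Module.Basis.is_basis_iff_det bas).2 hunit
  refine ⟨(Basis.mk hli hsp.ge).reindex e, fun b => ?_⟩
  simp [v]


lemma exists_coord {s : Finset Λ} (hs : IsPrimitiveSimplex s) {a r : Λ} (ha : a ∈ s) (hr : r ∈ s)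
    (har : a ≠ r) : ∃ (f : Λ →ₗ[ℤ] ℤ) (F : RealSpace Λ →ₗ[ℝ] ℝ), (∀ x, F (toReal x) = f x) ∧
      f (a - r) = 1 ∧ ∀ c ∈ s, c ≠ a → f (c - r) = 0 := by
  classical
  obtain ⟨B, hB⟩ := hs.exists_basis hr
  refine ⟨B.coord ⟨a, ha, har⟩, (B.baseChange ℝ).coord ⟨a, ha, har⟩, fun x => ?_, ?_, ?_⟩
  · simp [toReal_apply]
  · rw [← hB ⟨a, ha, har⟩]; simp
  · intro c hc hca
    by_cases hcr : c = r
    · subst hcr; simp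
    · rw [← hB ⟨c, hc, hcr⟩]
      simp [hca]

lemma ext_of_basis {s : Finset Λ} (hs : IsPrimitiveSimplex s) {r : Λ} (hr : r ∈ s)
    {M : Type*} [AddCommGroup M] (f g : Λ →ₗ[ℤ] M) (h : ∀ c ∈ s, f (c - r) = g (c - r)) : f = g := by
  obtain ⟨B, hB⟩ := hs.exists_basis hr
  exact B.ext fun i => by rw [hB]; exact h _ i.2.1

/-- `Tσ(ℤ)`: the lattice vectors lying in the direction of the real affine span of `σ`. -/
noncomputable def tangentLattice (s : Finset Λ) : Submodule ℤ Λ :=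
  ((vectorSpan ℝ (toReal '' (s : Set Λ))).restrictScalars ℤ).comap toReal

/-- `Tσ(𝔽₂)`, as a subspace of `t^*(𝔽₂)`. -/
noncomputable def tangentModTwo (s : Finset Λ) : Submodule (ZMod 2) (ModTwo Λ) :=
  Submodule.span (ZMod 2) (red '' (tangentLattice s : Set Λ))

lemma tangentModTwo_mono {s t : Finset Λ} (h : s ⊆ t) : tangentModTwo s ≤ tangentModTwo t := by
  apply Submodule.span_mono
  apply Set.image_mono
  intro x hx
  exact vectorSpan_mono ℝ (Set.image_mono (by exact_mod_cast h)) hx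

lemma sub_mem_tangentLattice {s : Finset Λ} {a b : Λ} (ha : a ∈ s) (hb : b ∈ s) :
    b - a ∈ tangentLattice s := by
  have := vsub_mem_vectorSpan ℝ (Set.mem_image_of_mem toReal (show b ∈ (s : Set Λ) from hb))
    (Set.mem_image_of_mem toReal (show a ∈ (s : Set Λ) from ha))
  simpa [tangentLattice] using this

lemma red_sub_mem {s : Finset Λ} {a b : Λ} (ha : a ∈ s) (hb : b ∈ s) :
    red (b - a) ∈ tangentModTwo s :=
  Submodule.subset_span ⟨_, sub_mem_tangentLattice ha hb, rfl⟩

lemma tangentLattice_le {s t : Finset Λ} (ht : IsPrimitiveSimplex t) (hst : s ⊆ t) {r : Λ}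
    (hr : r ∈ s) : tangentLattice s ≤ Submodule.span ℤ ((fun c => c - r) '' (s : Set Λ)) := by
  classical
  intro x hx
  obtain ⟨B, hB⟩ := ht.exists_basis (hst hr)
  have hx' : toReal x ∈ vectorSpan ℝ (toReal '' (s : Set Λ)) := hx
  have hz : ∀ i, i.1 ∉ s → B.repr x i = 0 := by
    intro i hi
    have hle : vectorSpan ℝ (toReal '' (s : Set Λ)) ≤ LinearMap.ker ((B.baseChange ℝ).coord i) := by
      rw [vectorSpan_eq_span_vsub_set_right ℝ (Set.mem_image_of_mem toReal (show r ∈ (s : Set Λ) from hr)),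
        Submodule.span_le]
      rintro _ ⟨_, ⟨c, hc, rfl⟩, rfl⟩
      have hc' : c ∈ s := hc
      simp only [vsub_eq_sub, ← map_sub, SetLike.mem_coe, LinearMap.mem_ker]
      by_cases hcr : c = r
      · subst hcr; simp
      · have : c - r = B ⟨c, hst hc', hcr⟩ := (hB ⟨c, hst hc', hcr⟩).symm
        rw [this, toReal_apply]
        have hne : (⟨c, hst hc', hcr⟩ : {b // b ∈ t ∧ b ≠ r}) ≠ i := by
          rintro rfl; exact hi hc'
        simp [hne]
    have := hle hx'
    simpa [toReal_apply] using this
  rw [← B.linearCombination_repr x, Finsupp.linearCombination_apply]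
  refine Submodule.sum_mem _ fun i hi => Submodule.smul_mem _ _ ?_
  have : i.1 ∈ s := by
    by_contra h
    exact (Finsupp.mem_support_iff.1 hi) (hz i h)
  exact Submodule.subset_span ⟨i.1, this, (hB i).symm⟩

lemma cotangent_ext {s t : Finset Λ} (ht : IsPrimitiveSimplex t) (hst : s ⊆ t)
    {r : Λ} (hr : r ∈ s)
    (v w : Dual (ZMod 2) (tangentModTwo s))
    (h : ∀ c (hc : c ∈ s), v ⟨red (c - r), red_sub_mem hr hc⟩ = w ⟨red (c - r), red_sub_mem hr hc⟩) :
    v = w := by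
  have h1 : ∀ x (hx : x ∈ tangentLattice s),
      v ⟨red x, Submodule.subset_span ⟨x, hx, rfl⟩⟩ = w ⟨red x, Submodule.subset_span ⟨x, hx, rfl⟩⟩ := by
    intro x hx
    let ι : tangentLattice s →ₗ[ℤ] tangentModTwo s :=
      { toFun := fun y => ⟨red y.1, Submodule.subset_span ⟨y.1, y.2, rfl⟩⟩
        map_add' := fun y z => by ext; simp
        map_smul' := fun k y => by ext; simp }
    have hle : tangentLattice s ≤
        (LinearMap.ker ((v - w).toAddMonoidHom.toIntLinearMap ∘ₗ ι)).map (tangentLattice s).subtype := by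
      refine (tangentLattice_le ht hst hr).trans ?_
      rw [Submodule.span_le]
      rintro _ ⟨c, hc, rfl⟩
      refine ⟨⟨c - r, sub_mem_tangentLattice hr hc⟩, ?_, rfl⟩
      simpa [ι, sub_eq_zero] using h c hc
    obtain ⟨y, hy, rfl⟩ := hle hx
    simpa [ι, sub_eq_zero] using hy
  ext ⟨y, hy⟩
  induction hy using Submodule.span_induction with
  | mem y hy => obtain ⟨x, hx, rfl⟩ := hy; exact h1 x hx
  | zero => exact (map_zero v).trans (map_zero w).symm
  | add x y hx hy h1 h2 =>
    exact (map_add v ⟨x, hx⟩ ⟨y, hy⟩).trans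
      ((congrArg₂ (· + ·) h1 h2).trans (map_add w ⟨x, hx⟩ ⟨y, hy⟩).symm)
  | smul a x hx h1 =>
    exact (map_smul v a ⟨x, hx⟩).trans
      ((congrArg (a • ·) h1).trans (map_smul w a ⟨x, hx⟩).symm)

/-- The map `z¹_σ : v ↦ [edge αβ ↦ ω(αβ)(v)]`, where `ω(αβ)` is the reduction of `β - α` modulo two;
1-cochains of `σ` are written as functions of the ordered pairs of vertices of `σ`. -/
noncomputable def edgeEvaluation (s : Finset Λ) :
    Dual (ZMod 2) (tangentModTwo s) →ₗ[ZMod 2] (s → s → ZMod 2) where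
  toFun v α β := v ⟨red (β.1 - α.1), red_sub_mem α.2 β.2⟩
  map_add' _ _ := rfl
  map_smul' _ _ := rfl

lemma existsUnique_edgeEvaluation {s : Finset Λ} (hs : IsPrimitiveSimplex s) (ε : s → ZMod 2) :
    ∃! v : Dual (ZMod 2) (tangentModTwo s), edgeEvaluation s v = fun α β => ε β - ε α := by
  classical
  obtain ⟨r, hr⟩ : s.Nonempty := by
    rw [← Finset.card_pos, hs.1]; omega
  obtain ⟨B, hB⟩ := hs.exists_basis hr
  let V : Dual (ZMod 2) (ModTwo Λ) :=
    ((B.baseChange (ZMod 2)).map (modTwoEquiv Λ).symm).constr (ZMod 2) (fun i => ε ⟨i.1, i.2.1⟩ - ε ⟨r, hr⟩)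
  have hV : ∀ c : s, V (red (c.1 - r)) = ε c - ε ⟨r, hr⟩ := by
    rintro ⟨c, hc⟩
    by_cases hcr : c = r
    · subst hcr; simp
    · have h1 : red (c - r) = (B.baseChange (ZMod 2)).map (modTwoEquiv Λ).symm ⟨c, hc, hcr⟩ := by
        rw [Basis.map_apply, Basis.baseChange_apply, hB]; rfl
      rw [h1]
      exact Basis.constr_basis _ _ _ _
  refine ⟨V.domRestrict _, ?_, ?_⟩
  · ext α β
    have h1 : red (β.1 - α.1) = red (β.1 - r) - red (α.1 - r) := by
      rw [← map_sub]; congr 1; abel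
    change V (red (β.1 - α.1)) = _
    rw [h1, map_sub, hV, hV]; ring
  · intro w hw
    refine cotangent_ext hs subset_rfl hr _ _ fun c hc => ?_
    have := congrFun (congrFun hw ⟨r, hr⟩) ⟨c, hc⟩
    exact this.trans (hV ⟨c, hc⟩).symm

variable (Λ) in
/-- A primitive complex in `t^*(ℝ)`: a finite simplicial complex affinely embedded in `t^*(ℝ)` (a simplex is
recorded by its set of vertices, which are lattice points), purely of dimension `n`, whose
`n`-simplices, hence also their faces, are primitive. -/
structure PrimitiveComplex extends PreAbstractSimplicialComplex Λ where
  finite_faces : faces.Finite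
  indep : ∀ s ∈ faces, AffineIndependent ℝ (fun v : s => toReal v.1)
  inter_subset_convexHull : ∀ s ∈ faces, ∀ t ∈ faces,
    convexHull ℝ (toReal '' (s : Set Λ)) ∩ convexHull ℝ (toReal '' (t : Set Λ)) ⊆
      convexHull ℝ (toReal '' ((s : Set Λ) ∩ t))
  pure : ∀ s ∈ faces, ∃ t ∈ faces, s ⊆ t ∧ t.card = finrank ℤ Λ + 1
  primitive : ∀ s ∈ faces, s.card = finrank ℤ Λ + 1 → IsPrimitiveSimplex s

namespace PrimitiveComplex
variable (K : PrimitiveComplex Λ)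

lemma opposite_side [DecidableEq Λ] {ρ : Finset Λ} {r a b : Λ} (hr : r ∈ ρ) (ha : a ∉ ρ)
    (hb : b ∉ ρ) (hab : a ≠ b) (hρa : insert a ρ ∈ K.faces) (hρb : insert b ρ ∈ K.faces)
    (hpa : IsPrimitiveSimplex (insert a ρ)) (hpb : IsPrimitiveSimplex (insert b ρ))
    (f : Λ →ₗ[ℤ] ℤ) (hfb : f (b - r) = 1) (hf : ∀ c ∈ ρ, f (c - r) = 0) : f (a - r) = -1 := by
  obtain ⟨g, G, hG, hga, hg⟩ := exists_coord hpa (Finset.mem_insert_self a ρ)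
    (Finset.mem_insert_of_mem hr) (by rintro rfl; exact ha hr)
  have hgρ : ∀ c ∈ ρ, g (c - r) = 0 := fun c hc =>
    hg c (Finset.mem_insert_of_mem hc) (by rintro rfl; exact ha hc)
  have hgf : g = g (b - r) • f := by
    apply ext_of_basis hpb (Finset.mem_insert_of_mem hr)
    intro c hc
    rcases Finset.mem_insert.1 hc with rfl | hc
    · simp [hfb]
    · simp [hf c hc, hgρ c hc]
  have hmul : g (b - r) * f (a - r) = 1 := by
    have := congrArg (fun h : Λ →ₗ[ℤ] ℤ => h (a - r)) hgf
    simpa [hga] using this.symm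
  rcases Int.isUnit_iff.1 (IsUnit.of_mul_eq_one _ ((mul_comm _ _).trans hmul)) with h1 | h1
  swap
  · exact h1
  exfalso
  obtain ⟨M, hM0, hMa⟩ : ∃ M : Λ → ℤ, ∑ c ∈ ρ, M c = 0 ∧ a = b + ∑ c ∈ ρ, M c • c := by
    have hmem : a - b ∈ Submodule.span ℤ ((fun c => c - r) '' (ρ : Set Λ)) := by
      obtain ⟨B, hB⟩ := hpb.exists_basis (Finset.mem_insert_of_mem hr : r ∈ insert b ρ)
      have hbr : b ≠ r := by rintro rfl; exact hb hr
      have hfc : f = B.coord ⟨b, Finset.mem_insert_self _ _, hbr⟩ := by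
        refine B.ext fun i => ?_
        obtain ⟨i, hi, hir⟩ := i
        rcases Finset.mem_insert.1 hi with rfl | hi'
        · rw [Basis.coord_apply, Basis.repr_self, Finsupp.single_eq_same, hB, hfb]
        · have : i ≠ b := by rintro rfl; exact hb hi'
          rw [Basis.coord_apply, Basis.repr_self, Finsupp.single_eq_of_ne (by simpa using Ne.symm this),
            hB]
          exact hf i hi'
      have h0 : B.repr (a - b) ⟨b, Finset.mem_insert_self _ _, hbr⟩ = 0 := by
        have h2 : f (a - b) = 0 := by
          have : a - b = (a - r) - (b - r) := by abel
          rw [this, map_sub, h1, hfb]; rfl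
        rw [hfc] at h2; exact h2
      rw [← B.linearCombination_repr (a - b), Finsupp.linearCombination_apply]
      refine Submodule.sum_mem _ fun i hi => Submodule.smul_mem _ _ ?_
      have : i.1 ∈ ρ := by
        rcases Finset.mem_insert.1 i.2.1 with h | h
        · exfalso
          apply Finsupp.mem_support_iff.1 hi
          convert h0
        · exact h
      exact Submodule.subset_span ⟨i.1, this, (hB i).symm⟩
    rw [← Finset.coe_image, Submodule.mem_span_finset] at hmem
    obtain ⟨u, -, hu⟩ := hmem
    rw [Finset.sum_image (by intro x _ y _ h; simpa using h)] at hu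
    refine ⟨fun c => u (c - r) - if c = r then ∑ c ∈ ρ, u (c - r) else 0, ?_, ?_⟩
    · simp [Finset.sum_sub_distrib, hr]
    · simp only [sub_smul, Finset.sum_sub_distrib, ite_smul, zero_smul, Finset.sum_ite_eq', hr,
        if_true]
      rw [← sub_eq_iff_eq_add', ← hu, Finset.sum_smul, ← Finset.sum_sub_distrib]
      simp [smul_sub]
  set S : ℝ := 1 + ∑ c ∈ ρ, |(M c : ℝ)| with hS
  have hSpos : 0 < S := by
    have : 0 ≤ ∑ c ∈ ρ, |(M c : ℝ)| := Finset.sum_nonneg fun _ _ => abs_nonneg _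
    linarith
  let p : RealSpace Λ := S⁻¹ • (toReal a + ∑ c ∈ ρ, |(M c : ℝ)| • toReal c)
  have hpa' : p ∈ convexHull ℝ (toReal '' ((insert a ρ : Finset Λ) : Set Λ)) := by
    rw [mem_convexHull_toReal]
    refine ⟨fun c => if c = a then S⁻¹ else S⁻¹ * |(M c : ℝ)|, ?_, ?_, ?_⟩
    · intro c _; dsimp only; split_ifs <;> positivity
    · rw [Finset.sum_insert ha, if_pos rfl, Finset.sum_congr rfl (fun c hc => if_neg (by
        rintro rfl; exact ha hc)), ← Finset.mul_sum]
      field_simp; rw [hS]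
    · dsimp only
      rw [Finset.sum_insert ha, if_pos rfl, Finset.sum_congr rfl (fun c hc => by
        rw [if_neg (by rintro rfl; exact ha hc)])]
      simp only [p, smul_add, Finset.smul_sum, smul_smul]
  have hpb' : p ∈ convexHull ℝ (toReal '' ((insert b ρ : Finset Λ) : Set Λ)) := by
    rw [mem_convexHull_toReal]
    refine ⟨fun c => if c = b then S⁻¹ else S⁻¹ * (|(M c : ℝ)| + M c), ?_, ?_, ?_⟩
    · intro c _; dsimp only
      have : 0 ≤ |(M c : ℝ)| + M c := by linarith [neg_abs_le (M c : ℝ)]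
      split_ifs <;> positivity
    · rw [Finset.sum_insert hb, if_pos rfl, Finset.sum_congr rfl (fun c hc => if_neg (by
        rintro rfl; exact hb hc)), ← Finset.mul_sum, Finset.sum_add_distrib]
      have : ∑ c ∈ ρ, (M c : ℝ) = 0 := by exact_mod_cast hM0
      rw [this]
      field_simp; rw [hS]; ring
    · dsimp only
      rw [Finset.sum_insert hb, if_pos rfl, Finset.sum_congr rfl (fun c hc => by
        rw [if_neg (by rintro rfl; exact hb hc)])]
      have h2 : toReal a = toReal b + ∑ c ∈ ρ, (M c : ℝ) • toReal c := by
        conv_lhs => rw [hMa]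
        simp [map_sum, Int.cast_smul_eq_zsmul]
      simp only [p, h2, smul_add, Finset.smul_sum, smul_smul, mul_add, add_smul,
        Finset.sum_add_distrib]
      abel
  have hpρ := K.inter_subset_convexHull _ hρa _ hρb ⟨hpa', hpb'⟩
  have hint : ((insert a ρ : Finset Λ) : Set Λ) ∩ ((insert b ρ : Finset Λ) : Set Λ) = ρ := by
    ext x
    simp only [Finset.coe_insert, Set.mem_inter_iff, Set.mem_insert_iff, Finset.mem_coe]
    constructor
    · rintro ⟨rfl | h, rfl | h'⟩
      · exact absurd rfl hab
      all_goals assumption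
    · intro h; exact ⟨Or.inr h, Or.inr h⟩
  rw [hint, mem_convexHull_toReal] at hpρ
  obtain ⟨w, -, hw1, hw⟩ := hpρ
  have hGc : ∀ c ∈ ρ, G (toReal c) = G (toReal r) := by
    intro c hc
    have := hgρ c hc
    rw [map_sub, sub_eq_zero] at this
    rw [hG, hG, this]
  have hGa : G (toReal a) = 1 + G (toReal r) := by
    rw [map_sub] at hga
    rw [hG, hG]
    have : g a = 1 + g r := by omega
    rw [this]; push_cast; rfl
  have e1 : G p = G (toReal r) := by
    rw [← hw, map_sum, Finset.sum_congr rfl (fun c hc => by rw [map_smul, hGc c hc]),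
      ← Finset.sum_smul, hw1, one_smul]
  have e2 : G p = S⁻¹ + G (toReal r) := by
    simp only [p, map_smul, map_add, map_sum, hGa]
    rw [Finset.sum_congr rfl (fun c hc => by rw [hGc c hc]), ← Finset.sum_smul, smul_eq_mul,
      smul_eq_mul]
    have : S⁻¹ * (1 + G (toReal r) + (∑ c ∈ ρ, |(M c : ℝ)|) * G (toReal r)) =
      S⁻¹ + S⁻¹ * S * G (toReal r) := by rw [hS]; ring
    rw [this, inv_mul_cancel₀ hSpos.ne', one_mul]
  have : S⁻¹ = 0 := by linarith
  exact (inv_pos.2 hSpos).ne' this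



instance : Finite (Face K.toPreAbstractSimplicialComplex) := K.finite_faces.to_subtype

/-- The simplices of `K`. -/
abbrev Face := TropicalShelling.Face K.toPreAbstractSimplicialComplex

/-- The `n`-simplices, i.e. the maximal simplices. -/
abbrev IsTop (σ : K.Face) : Prop := σ.1.card = finrank ℤ Λ + 1

lemma card_cofaces {ρ : K.Face} (hρ : ρ.1.card = finrank ℤ Λ) {τ₁ τ₂ τ₃ : K.Face}
    (h₁ : K.IsTop τ₁) (h₂ : K.IsTop τ₂) (h₃ : K.IsTop τ₃) (l₁ : ρ ≤ τ₁) (l₂ : ρ ≤ τ₂) (l₃ : ρ ≤ τ₃)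
    (h12 : τ₁ ≠ τ₂) (h13 : τ₁ ≠ τ₃) : τ₂ = τ₃ := by
  classical
  by_contra h23
  have key : ∀ τ : K.Face, K.IsTop τ → ρ ≤ τ → ∃ a, a ∉ ρ.1 ∧ insert a ρ.1 = τ.1 := by
    intro τ h l
    have hc : (τ.1 \ ρ.1).card = 1 := by
      rw [Finset.card_sdiff_of_subset l, h, hρ]; omega
    obtain ⟨a, ha⟩ := Finset.card_eq_one.1 hc
    have ha' : a ∈ τ.1 \ ρ.1 := by rw [ha]; simp
    refine ⟨a, (Finset.mem_sdiff.1 ha').2, ?_⟩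
    rw [Finset.insert_eq, ← ha, Finset.sdiff_union_of_subset l]
  obtain ⟨a, ha, hae⟩ := key τ₁ h₁ l₁
  obtain ⟨b, hb, hbe⟩ := key τ₂ h₂ l₂
  obtain ⟨c, hc, hce⟩ := key τ₃ h₃ l₃
  have hab : a ≠ b := by rintro rfl; exact h12 (Subtype.ext (hae.symm.trans hbe))
  have hac : a ≠ c := by rintro rfl; exact h13 (Subtype.ext (hae.symm.trans hce))
  have hbc : b ≠ c := by rintro rfl; exact h23 (Subtype.ext (hbe.symm.trans hce))
  have fa : insert a ρ.1 ∈ K.faces := hae ▸ τ₁.2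
  have fb : insert b ρ.1 ∈ K.faces := hbe ▸ τ₂.2
  have fc : insert c ρ.1 ∈ K.faces := hce ▸ τ₃.2
  have pa := K.primitive _ fa (by rw [hae]; exact h₁)
  have pb := K.primitive _ fb (by rw [hbe]; exact h₂)
  have pc := K.primitive _ fc (by rw [hce]; exact h₃)
  obtain ⟨r, hr⟩ := (K.isRelLowerSet_faces ρ.2).1
  obtain ⟨f, -, -, hfb, hf⟩ := exists_coord pb (Finset.mem_insert_self b ρ.1)
    (Finset.mem_insert_of_mem hr) (by rintro rfl; exact hb hr)
  obtain ⟨g, -, -, hgc, hg⟩ := exists_coord pc (Finset.mem_insert_self c ρ.1)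
    (Finset.mem_insert_of_mem hr) (by rintro rfl; exact hc hr)
  have hf' : ∀ x ∈ ρ.1, f (x - r) = 0 := fun x hx =>
    hf x (Finset.mem_insert_of_mem hx) (by rintro rfl; exact hb hx)
  have hg' : ∀ x ∈ ρ.1, g (x - r) = 0 := fun x hx =>
    hg x (Finset.mem_insert_of_mem hx) (by rintro rfl; exact hc hx)
  have e1 := K.opposite_side hr ha hb hab fa fb pa pb f hfb hf'
  have e2 := K.opposite_side hr hc hb hbc.symm fc fb pc pb f hfb hf'
  have e3 := K.opposite_side hr ha hc hac fa fc pa pc g hgc hg'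
  have hfg : f = f (c - r) • g := by
    apply ext_of_basis pc (Finset.mem_insert_of_mem hr)
    intro x hx
    rcases Finset.mem_insert.1 hx with rfl | hx
    · simp [hgc]
    · simp [hf' x hx, hg' x hx]
  have := congrArg (fun h : Λ →ₗ[ℤ] ℤ => h (a - r)) hfg
  simp [e1, e2, e3] at this

/-- The boundary `∂K`: the subcomplex made of the `(n-1)`-simplices that are contained in exactly one
maximal simplex, and of their faces. -/
def boundary : LowerSet K.Face :=
  lowerClosure {ρ | ρ.1.card = finrank ℤ Λ ∧ ∃! σ : K.Face, K.IsTop σ ∧ ρ ≤ σ}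


/-- The tangent spaces `σ ↦ Tσ(𝔽₂)`. -/
noncomputable def tangent (σ : K.Face) : Submodule (ZMod 2) (ModTwo Λ) := tangentModTwo σ.1

lemma tangent_mono : Monotone K.tangent := fun _ _ h => tangentModTwo_mono h

/-- The normal cosheaf `N(σ) = (Tσ)^⊥(𝔽₂) ⊆ t(𝔽₂)`. -/
noncomputable def normalCosheaf : Cosheaf K.toPreAbstractSimplicialComplex :=
  annihilatorCosheaf K.tangent K.tangent_mono

/-- The cotangent cosheaf `T^*(σ) = T^*σ(𝔽₂)`. -/
noncomputable def cotangentCosheaf : Cosheaf K.toPreAbstractSimplicialComplex :=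
  dualCosheaf K.tangent K.tangent_mono

/-- The short exact sequence of relative chain complexes induced by the exact sequence of cosheaves
`0 → N → t(𝔽₂) → T^* → 0`. -/
lemma normalSequence_shortExact : (relShortComplex K.boundary
    (annihilatorInclusion K.tangent K.tangent_mono) (restrictionToDual K.tangent K.tangent_mono)
    (annihilatorInclusion_comp K.tangent K.tangent_mono)).ShortExact :=
  annihilatorSequence_shortExact _ _ _

/-- The vertices of `K`. -/
abbrev Vertex : Type u := {v : Λ // {v} ∈ K.faces}

/-- `C^0(K; 𝔽₂)`. -/
abbrev SignDistribution : Type u := K.Vertex → ZMod 2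

variable {K} in
/-- A vertex of a simplex of `K` as a vertex of `K`. -/
def vertexOf (σ : K.Face) (v : σ.1) : K.Vertex :=
  ⟨v.1, (K.isRelLowerSet_faces σ.2).2 (Finset.singleton_subset_iff.2 v.2) (Finset.singleton_nonempty _)⟩

/-- `(z¹_σ)⁻¹(dε|_σ)` for an `n`-simplex `σ`: the only `v` with `z¹_σ(v) = dε|_σ`. -/
noncomputable def derivativeAt (σ : K.Face) (h : K.IsTop σ) (ε : K.SignDistribution) :
    Dual (ZMod 2) (tangentModTwo σ.1) :=
  (existsUnique_edgeEvaluation (K.primitive _ σ.2 h) (fun v => ε (vertexOf σ v))).choose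

lemma derivativeAt_spec (σ : K.Face) (h : K.IsTop σ) (ε : K.SignDistribution) :
    edgeEvaluation σ.1 (K.derivativeAt σ h ε) =
      fun α β => ε (vertexOf σ β) - ε (vertexOf σ α) :=
  (existsUnique_edgeEvaluation (K.primitive _ σ.2 h) (fun v => ε (vertexOf σ v))).choose_spec.1

lemma eq_derivativeAt (σ : K.Face) (h : K.IsTop σ) (ε : K.SignDistribution)
    (v : Dual (ZMod 2) (tangentModTwo σ.1))
    (hv : edgeEvaluation σ.1 v = fun α β => ε (vertexOf σ β) - ε (vertexOf σ α)) :
    v = K.derivativeAt σ h ε :=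
  (existsUnique_edgeEvaluation (K.primitive _ σ.2 h) (fun v => ε (vertexOf σ v))).choose_spec.2 _ hv

/-- The relative `n`-chain `∑_σ (z¹_σ)⁻¹(dε|_σ) ⊗ σ` of `(K, ∂K)`. No `n`-simplex belongs to `∂K`. -/
noncomputable def derivativeChain :
    K.SignDistribution →ₗ[ZMod 2] RelChain K.boundary K.cotangentCosheaf (finrank ℤ Λ) where
  toFun ε σ := K.derivativeAt σ.1 σ.2.1 ε
  map_add' ε ε' := by
    funext σ
    symm
    apply eq_derivativeAt
    refine (map_add (edgeEvaluation σ.1.1) (K.derivativeAt σ.1 σ.2.1 ε) (K.derivativeAt σ.1 σ.2.1 ε')).trans ?_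
    rw [derivativeAt_spec, derivativeAt_spec]
    funext α β
    simp only [Pi.add_apply]; ring
  map_smul' a ε := by
    funext σ
    symm
    apply eq_derivativeAt
    refine (map_smul (edgeEvaluation σ.1.1) a (K.derivativeAt σ.1 σ.2.1 ε)).trans ?_
    rw [derivativeAt_spec]
    funext α β
    simp only [Pi.smul_apply, smul_eq_mul]; ring

lemma isTop_notMem_boundary {τ : K.Face} (h : K.IsTop τ) : τ ∉ K.boundary := by
  rintro ⟨ρ, ⟨hρ, -⟩, hle⟩
  have := Finset.card_le_card (show τ.1 ⊆ ρ.1 from hle)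
  rw [h, hρ] at this
  omega

lemma derivativeChain_cycle (hn : 1 ≤ finrank ℤ Λ) (ε : K.SignDistribution) :
    relBoundary K.boundary K.cotangentCosheaf (finrank ℤ Λ) (finrank ℤ Λ - 1)
      (K.derivativeChain ε) = 0 := by
  classical
  funext σ
  rw [relBoundary_apply]
  have hσ : σ.1.1.card = finrank ℤ Λ := by rw [σ.2.1]; omega
  obtain ⟨τ₁, hτ₁f, hστ₁, hτ₁⟩ := K.pure _ σ.1.2
  have hnot : ¬ ∃! τ : K.Face, K.IsTop τ ∧ σ.1 ≤ τ := fun h =>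
    σ.2.2 (subset_lowerClosure ⟨hσ, h⟩)
  obtain ⟨τ₂, ⟨hτ₂, hστ₂⟩, hne⟩ : ∃ τ : K.Face, (K.IsTop τ ∧ σ.1 ≤ τ) ∧ τ ≠ ⟨τ₁, hτ₁f⟩ := by
    by_contra! h
    exact hnot ⟨⟨τ₁, hτ₁f⟩, ⟨hτ₁, hστ₁⟩, h⟩
  let t₁ : {τ : Cell K.boundary (finrank ℤ Λ) // σ.1 ≤ τ.1} :=
    ⟨⟨⟨τ₁, hτ₁f⟩, hτ₁, K.isTop_notMem_boundary hτ₁⟩, hστ₁⟩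
  let t₂ : {τ : Cell K.boundary (finrank ℤ Λ) // σ.1 ≤ τ.1} :=
    ⟨⟨τ₂, hτ₂, K.isTop_notMem_boundary hτ₂⟩, hστ₂⟩
  have ht : t₁ ≠ t₂ := fun h => hne (congrArg (fun t => t.1.1) h).symm
  rw [Fintype.sum_eq_add t₁ t₂ ht]
  · have hval : ∀ (t : {τ : Cell K.boundary (finrank ℤ Λ) // σ.1 ≤ τ.1})
        (α β : Λ) (hα : α ∈ σ.1.1) (hβ : β ∈ σ.1.1),
        (Submodule.inclusion (K.tangent_mono t.2)).dualMap (K.derivativeAt t.1.1 t.1.2.1 ε)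
          ⟨red (β - α), red_sub_mem hα hβ⟩ =
        ε (vertexOf σ.1 ⟨β, hβ⟩) - ε (vertexOf σ.1 ⟨α, hα⟩) := fun t α β hα hβ =>
      congrFun (congrFun (K.derivativeAt_spec t.1.1 t.1.2.1 ε) ⟨α, t.2 hα⟩) ⟨β, t.2 hβ⟩
    obtain ⟨r, hr⟩ := (K.isRelLowerSet_faces σ.1.2).1
    have heq : (Submodule.inclusion (K.tangent_mono t₁.2)).dualMap
          (K.derivativeAt t₁.1.1 t₁.1.2.1 ε) =
        (Submodule.inclusion (K.tangent_mono t₂.2)).dualMap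
          (K.derivativeAt t₂.1.1 t₂.1.2.1 ε) :=
      cotangent_ext (K.primitive _ hτ₁f hτ₁) hστ₁ hr _ _ fun c hc =>
        (hval t₁ r c hr hc).trans (hval t₂ r c hr hc).symm
    have hadd : ∀ x y : Dual (ZMod 2) (K.tangent σ.1), x = y → x + y = 0 := by
      rintro x _ rfl
      exact ZModModule.add_self x
    exact hadd _ _ heq
  · rintro t ⟨h1, h2⟩
    exfalso
    refine h2 (Subtype.ext (Subtype.ext ?_))
    exact K.card_cofaces hσ hτ₁ t.1.2.1 hτ₂ hστ₁ t.2 hστ₂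
      (fun h => h1 (Subtype.ext (Subtype.ext h.symm))) hne.symm

lemma down_rel (hn : 1 ≤ finrank ℤ Λ) :
    (ComplexShape.down ℕ).Rel (finrank ℤ Λ) (finrank ℤ Λ - 1) := Nat.sub_add_cancel hn

/-- The first derivative `D : C^0(K; 𝔽₂) → H_n(K, ∂K; T^*)`. -/
noncomputable def firstDerivative (hn : 1 ≤ finrank ℤ Λ) : K.SignDistribution →ₗ[ZMod 2]
    relHomology K.boundary K.cotangentCosheaf (finrank ℤ Λ) :=
  ((relComplex K.boundary K.cotangentCosheaf).liftCycles' (ModuleCat.ofHom K.derivativeChain)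
    (finrank ℤ Λ - 1) (down_rel hn) (by
      rw [relComplex_d _ _ _ _ (Nat.sub_add_cancel hn)]
      ext ε : 2
      exact K.derivativeChain_cycle hn ε) ≫
    (relComplex K.boundary K.cotangentCosheaf).homologyπ (finrank ℤ Λ)).hom

/-- The connecting morphism `H_n(K, ∂K; T^*) → H_{n-1}(K, ∂K; N)` of `0 → N → t(𝔽₂) → T^* → 0`. -/
noncomputable def connecting (hn : 1 ≤ finrank ℤ Λ) :
    relHomology K.boundary K.cotangentCosheaf (finrank ℤ Λ) →ₗ[ZMod 2]
      relHomology K.boundary K.normalCosheaf (finrank ℤ Λ - 1) :=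
  (K.normalSequence_shortExact.δ (finrank ℤ Λ) (finrank ℤ Λ - 1) (down_rel hn)).hom

/-- The second derivative `D² : C^0(K; 𝔽₂) → H_{n-1}(K, ∂K; N)`. -/
noncomputable def secondDerivative (hn : 1 ≤ finrank ℤ Λ) : K.SignDistribution →ₗ[ZMod 2]
    relHomology K.boundary K.normalCosheaf (finrank ℤ Λ - 1) :=
  K.connecting hn ∘ₗ K.firstDerivative hn


/-- The inclusion `𝔽₂ → C^0(K; 𝔽₂)` of the constants. -/
noncomputable def constantDistribution : ZMod 2 →ₗ[ZMod 2] K.SignDistribution where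
  toFun c _ := c
  map_add' _ _ := rfl
  map_smul' _ _ := rfl

/-- The restriction `Aff(t^*(𝔽₂)) → C^0(K; 𝔽₂)`: an affine function is evaluated at the vertices reduced
modulo two. -/
noncomputable def affineDistribution :
    (ModTwo Λ →ᵃ[ZMod 2] ZMod 2) →ₗ[ZMod 2] K.SignDistribution where
  toFun f v := f (red v.1)
  map_add' _ _ := rfl
  map_smul' _ _ := rfl

end PrimitiveComplex
end Lattice
end TropicalShelling

/-! Work in the dual graph: its vertices are the n-simplices σ_i, its edges the facets
((n-1)-simplices) outside ∂K, each lying in exactly two n-simplices by `card_cofaces`. Modulo 2, a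
function z on these facets is the boundary of a constant-coefficient n-chain h exactly when z(ρ) =
h_i + h_j for the two cofaces σ_i, σ_j of ρ. The key result, `exists_potential`, says that such an h
exists once z sums to zero over the facets around every codimension two face η whose star is closed.
One builds h along the shelling. If σ_i meets the earlier simplices in two facets ρ and ρ₀, then the
star of η = ρ ∩ ρ₀ closes at that very step, because η never has more than two free facets
(`freeFacets_card_le`, `star_closed`). The relation around η then makes the values that ρ and ρ₀
impose on h_i agree.

This is used twice. With values in t(𝔽₂), the relation at η is the cycle condition, so H_{n-1}(K,
∂K; t(𝔽₂)) = 0. With values in 𝔽₂, it integrates a T^*-cycle: lift each coefficient to a linear form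
e_i on t^*(𝔽₂). The cycle condition makes e_i + e_j constant on a shared facet, and a potential h
for these constants makes the functions e_i + h_i agree on common vertices. They glue to a sign
distribution, so D is surjective. Its kernel is the constants, since the dual graph is connected.

For D², use the exact sequence H_n(t(𝔽₂)) → H_n(T^*) → H_{n-1}(N) → H_{n-1}(t(𝔽₂)) = 0, all relative
to ∂K. The relative n-cycles with values in t(𝔽₂) are the constant ones, and their images in
H_n(T^*) are the derivatives of affine functions. Hence D² is surjective with kernel the affine
functions.

In dimension one η is empty and carries no cycle condition; the embedding in a line rules out a
closed star there. -/

namespace TropicalShelling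

open scoped TensorProduct
open CategoryTheory MeasureTheory Module

/-! ### Shellings of non-branching complexes and stars of codimension two faces -/

section Combinatorics

variable {ι : Type u}

/-- A list of sets with `m + 2` elements, in which every set with `m + 1` elements lies in at most two
terms, and such that the intersection of a term with the union of the previous ones is a union of
facets, nonempty except for the first term. -/
structure ShelledPseudomanifold {k : ℕ} (m : ℕ) (σ : Fin (k + 1) → Finset ι) : Prop where
  card_eq : ∀ i, (σ i).card = m + 2
  not_branching : ∀ ρ : Finset ι, ρ.card = m + 1 → ∀ a b c, ρ ⊆ σ a → ρ ⊆ σ b → ρ ⊆ σ c →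
    a ≠ b → a ≠ c → b = c
  exists_facet : ∀ i j, j < i → ∀ τ, τ ⊆ σ i → τ ⊆ σ j →
    ∃ ρ, τ ⊆ ρ ∧ ρ.card = m + 1 ∧ ρ ⊆ σ i ∧ ∃ j' < i, ρ ⊆ σ j'

/-- The dual graph is connected: every term after the first shares a facet with an earlier one, as
`exists_facet` with `τ = ∅` shows. -/
lemma ShelledPseudomanifold.eq_of_adjacent {k m : ℕ} {σ : Fin (k + 1) → Finset ι}
    (H : ShelledPseudomanifold m σ) {α : Type*} (h : Fin (k + 1) → α) (hh : ∀ i j, i ≠ j →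
    ∀ ρ : Finset ι, ρ.card = m + 1 → ρ ⊆ σ i → ρ ⊆ σ j → h i = h j) (i : Fin (k + 1)) : h i = h 0 := by
  induction i using WellFoundedLT.induction with
  | ind i ih =>
    by_cases hi : i = 0
    · rw [hi]
    · obtain ⟨ρ, -, h2, h3, l, h4, h5⟩ := H.exists_facet i 0 (Fin.pos_iff_ne_zero.2 hi) ∅
        (Finset.empty_subset _) (Finset.empty_subset _)
      rw [hh i l h4.ne' ρ h2 h3 h5, ih l h4]

variable [DecidableEq ι]

/-- The subsets of `s` with `m + 1` elements that contain `η`. -/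
def cofacets (m : ℕ) (η s : Finset ι) : Finset (Finset ι) :=
  (s.powersetCard (m + 1)).filter (η ⊆ ·)

lemma mem_cofacets {m : ℕ} {η s ρ : Finset ι} :
    ρ ∈ cofacets m η s ↔ ρ ⊆ s ∧ ρ.card = m + 1 ∧ η ⊆ ρ := by
  simp [cofacets, Finset.mem_powersetCard, and_assoc]

/-- A facet of `s` through `η` is `η` with one of the two remaining points of `s` added. -/
lemma cofacets_card {m : ℕ} {η s : Finset ι} (hη : η.card = m) (hs : s.card = m + 2)
    (h : η ⊆ s) : (cofacets m η s).card = 2 := by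
  have hc : (s \ η).card = 2 := by rw [Finset.card_sdiff_of_subset h]; omega
  have himg : cofacets m η s = (s \ η).image (insert · η) := by
    ext ρ
    rw [mem_cofacets, Finset.mem_image]
    constructor
    · rintro ⟨h1, h2, h3⟩
      obtain ⟨a, ha⟩ := Finset.card_eq_one.1
        (show (ρ \ η).card = 1 by rw [Finset.card_sdiff_of_subset h3]; omega)
      have ha' : a ∈ ρ \ η := by rw [ha]; simp
      rw [Finset.mem_sdiff] at ha'
      refine ⟨a, Finset.mem_sdiff.2 ⟨h1 ha'.1, ha'.2⟩, ?_⟩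
      rw [Finset.insert_eq, ← ha, Finset.sdiff_union_of_subset h3]
    · rintro ⟨a, ha, rfl⟩
      rw [Finset.mem_sdiff] at ha
      exact ⟨Finset.insert_subset ha.1 h, by rw [Finset.card_insert_of_notMem ha.2, hη],
        Finset.subset_insert _ _⟩
  rw [himg, Finset.card_image_of_injOn, hc]
  intro a ha b _ hab
  simp only [Finset.coe_sdiff, Set.mem_sdiff, Finset.mem_coe] at ha
  have : a ∈ insert b η := (show insert a η = insert b η from hab) ▸ Finset.mem_insert_self a η
  exact (Finset.mem_insert.1 this).resolve_right ha.2

namespace ShelledPseudomanifold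

variable {k m : ℕ} {σ : Fin (k + 1) → Finset ι}

variable (m σ) in
/-- The facets of the terms that contain `η`. -/
def star (η : Finset ι) : Finset (Finset ι) := Finset.univ.biUnion fun i => cofacets m η (σ i)

lemma mem_star {η ρ : Finset ι} : ρ ∈ star m σ η ↔ (∃ i, ρ ⊆ σ i) ∧ ρ.card = m + 1 ∧ η ⊆ ρ := by
  simp [star, mem_cofacets]

variable (m σ) in
open Classical in
/-- The facets containing `η` that lie in exactly one of the first `t` terms. -/
noncomputable def freeFacets (η : Finset ι) (t : ℕ) : Finset (Finset ι) :=
  (star m σ η).filter fun ρ => ∃! i : Fin (k + 1), i.1 < t ∧ ρ ⊆ σ i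

lemma mem_freeFacets {η ρ : Finset ι} {t : ℕ} : ρ ∈ freeFacets m σ η t ↔
    ρ.card = m + 1 ∧ η ⊆ ρ ∧ ∃! i : Fin (k + 1), i.1 < t ∧ ρ ⊆ σ i := by
  classical
  rw [freeFacets, Finset.mem_filter, mem_star]
  constructor
  · rintro ⟨⟨-, h⟩, h'⟩; exact ⟨h.1, h.2, h'⟩
  · rintro ⟨h1, h2, h3⟩; exact ⟨⟨h3.exists.imp fun _ h => h.2, h1, h2⟩, h3⟩

variable (H : ShelledPseudomanifold m σ)
include H

/-- One of the two possible cofaces of `ρ` is `σ i` itself, so only one is left among the earlier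
terms. -/
lemma mem_freeFacets_of_lt {η ρ : Finset ι} {i j : Fin (k + 1)} (hρ : ρ.card = m + 1) (hη : η ⊆ ρ)
    (hi : ρ ⊆ σ i) (hji : j < i) (hj : ρ ⊆ σ j) : ρ ∈ freeFacets m σ η i.1 := by
  refine mem_freeFacets.2 ⟨hρ, hη, j, ⟨hji, hj⟩, fun b hb => ?_⟩
  exact H.not_branching ρ hρ i b j hi hb.2 hj (ne_of_gt (Fin.lt_def.2 hb.1)) (ne_of_gt hji)

/-- A new simplex through `η` has two facets through `η`. If `η` is already present, the shelling
condition gives such a facet that is shared with an earlier term: it was free and stops being so,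
while at most the other facet becomes free. The count therefore cannot grow beyond two. -/
lemma freeFacets_card_le {η : Finset ι} (hη : η.card = m) (t : ℕ) (ht : t ≤ k + 1) :
    (freeFacets m σ η t).card ≤ 2 := by
  induction t with
  | zero =>
    have : freeFacets m σ η 0 = ∅ := by
      refine Finset.eq_empty_of_forall_notMem fun ρ hρ => ?_
      obtain ⟨-, -, i, ⟨h, -⟩, -⟩ := mem_freeFacets.1 hρ
      omega
    simp [this]
  | succ t ih =>
    specialize ih (by omega)
    let i : Fin (k + 1) := ⟨t, by omega⟩
    -- After adding `σ i`, a free facet is either a facet of `σ i` not met before, or an old free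
    -- facet that `σ i` avoids.
    have key : ∀ ρ ∈ freeFacets m σ η (t + 1),
        ρ ∈ cofacets m η (σ i) ∧ (¬ ∃ j < i, ρ ⊆ σ j) ∨ ¬ ρ ⊆ σ i ∧ ρ ∈ freeFacets m σ η t := by
      intro ρ hρ
      obtain ⟨h1, h2, l, ⟨hl, hl'⟩, hu⟩ := mem_freeFacets.1 hρ
      rcases Nat.lt_succ_iff_lt_or_eq.1 hl with h | h
      · refine Or.inr ⟨fun hi => ?_, mem_freeFacets.2 ⟨h1, h2, l, ⟨h, hl'⟩,
          fun b hb => hu b ⟨by omega, hb.2⟩⟩⟩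
        have := congrArg Fin.val (hu i ⟨Nat.lt_succ_self t, hi⟩)
        change t = l.1 at this
        omega
      · obtain rfl : l = i := Fin.ext h
        refine Or.inl ⟨mem_cofacets.2 ⟨hl', h1, h2⟩, ?_⟩
        rintro ⟨j, hj, hj'⟩
        exact hj.ne (hu j ⟨(Fin.lt_def.1 hj).trans (Nat.lt_succ_self t), hj'⟩)
    by_cases hi : η ⊆ σ i
    · have hc := cofacets_card hη (H.card_eq i) hi
      by_cases hj : ∃ j < i, η ⊆ σ j
      · obtain ⟨j, hji, hj⟩ := hj
        obtain ⟨ρ, h1, h2, h3, j', h4, h5⟩ := H.exists_facet i j hji η hi hj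
        have m1 : ρ ∈ freeFacets m σ η t := H.mem_freeFacets_of_lt h2 h1 h3 h4 h5
        have m2 : ρ ∈ cofacets m η (σ i) := mem_cofacets.2 ⟨h3, h2, h1⟩
        -- The shared facet `ρ` leaves both sets, which gives the bound `(2 - 1) + (2 - 1)`.
        have hsub : freeFacets m σ η (t + 1) ⊆
            (cofacets m η (σ i)).erase ρ ∪ (freeFacets m σ η t).erase ρ := by
          intro ρ' hρ'
          rw [Finset.mem_union, Finset.mem_erase, Finset.mem_erase]
          rcases key ρ' hρ' with ⟨h, h'⟩ | ⟨h, h'⟩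
          · exact Or.inl ⟨by rintro rfl; exact h' ⟨j', h4, h5⟩, h⟩
          · exact Or.inr ⟨by rintro rfl; exact h h3, h'⟩
        have := (Finset.card_le_card hsub).trans (Finset.card_union_le _ _)
        rw [Finset.card_erase_of_mem m1, Finset.card_erase_of_mem m2] at this
        omega
      · rw [← hc]
        refine Finset.card_le_card fun ρ hρ => ?_
        rcases key ρ hρ with ⟨h, -⟩ | ⟨-, h⟩
        · exact h
        · obtain ⟨-, h2, l, ⟨hl, hl'⟩, -⟩ := mem_freeFacets.1 h
          exact absurd ⟨l, hl, h2.trans hl'⟩ hj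
    · refine (Finset.card_le_card fun ρ hρ => ?_).trans ih
      rcases key ρ hρ with ⟨h, -⟩ | ⟨-, h⟩
      · obtain ⟨h1, -, h2⟩ := mem_cofacets.1 h
        exact absurd (h2.trans h1) hi
      · exact h

/-- If two facets of `σ i` containing a codimension two face `η` belong to previous terms, then the star
of `η` is closed, and complete at the `i`-th step. -/
lemma star_closed {η ρ ρ' : Finset ι} (hη : η.card = m) {i j j' : Fin (k + 1)}
    (hρ : ρ ∈ cofacets m η (σ i)) (hρ' : ρ' ∈ cofacets m η (σ i)) (hne : ρ ≠ ρ')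
    (hj : j < i) (hρj : ρ ⊆ σ j) (hj' : j' < i) (hρj' : ρ' ⊆ σ j') :
    ∀ ρ'' ∈ star m σ η, ∀ a, ρ'' ⊆ σ a → a ≤ i ∧ ∃ b ≤ i, b ≠ a ∧ ρ'' ⊆ σ b := by
  obtain ⟨p1, p2, p3⟩ := mem_cofacets.1 hρ
  obtain ⟨q1, q2, q3⟩ := mem_cofacets.1 hρ'
  have hpair : ({ρ, ρ'} : Finset (Finset ι)).card = 2 := Finset.card_pair hne
  -- By the bound of two, `ρ` and `ρ'` are all the free facets before step `i`; they are also all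
  -- the facets of `σ i` through `η`, so `σ i` closes the star.
  have e1 : {ρ, ρ'} = freeFacets m σ η i.1 := by
    refine Finset.eq_of_subset_of_card_le ?_
      (hpair ▸ H.freeFacets_card_le hη i.1 (by omega))
    intro x hx
    rcases Finset.mem_insert.1 hx with rfl | hx
    · exact H.mem_freeFacets_of_lt p2 p3 p1 hj hρj
    · rw [Finset.mem_singleton.1 hx]
      exact H.mem_freeFacets_of_lt q2 q3 q1 hj' hρj'
  have e2 : {ρ, ρ'} = cofacets m η (σ i) := by
    refine Finset.eq_of_subset_of_card_le ?_ ?_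
    · intro x hx
      rcases Finset.mem_insert.1 hx with rfl | hx
      · exact hρ
      · rwa [Finset.mem_singleton.1 hx]
    · rw [hpair, cofacets_card hη (H.card_eq i) (p3.trans p1)]
  have c1 : ∀ ρ'' ∈ star m σ η, ∀ a ≤ i, ρ'' ⊆ σ a → ∃ b ≤ i, b ≠ a ∧ ρ'' ⊆ σ b := by
    intro ρ'' h a ha hρa
    obtain ⟨-, h2, h3⟩ := mem_star.1 h
    rcases ha.lt_or_eq with ha | rfl
    · by_contra! hcon
      have : ρ'' ∈ freeFacets m σ η i.1 := mem_freeFacets.2 ⟨h2, h3, a, ⟨ha, hρa⟩, fun b hb => by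
        by_contra hba
        exact hcon b (le_of_lt (Fin.lt_def.2 hb.1)) hba hb.2⟩
      rw [← e1, e2, mem_cofacets] at this
      exact hcon i le_rfl ha.ne' this.1
    · have : ρ'' ∈ ({ρ, ρ'} : Finset (Finset ι)) := e2 ▸ mem_cofacets.2 ⟨hρa, h2, h3⟩
      rcases Finset.mem_insert.1 this with rfl | hx
      · exact ⟨j, hj.le, hj.ne, hρj⟩
      · rw [Finset.mem_singleton.1 hx]
        exact ⟨j', hj'.le, hj'.ne, hρj'⟩
  -- A later simplex through `η` would attach along a facet of the star, and this facet already has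
  -- two cofaces of index at most `i`: a third is forbidden by `not_branching`.
  have c2 : ∀ a, η ⊆ σ a → a ≤ i := by
    intro a
    induction a using WellFoundedLT.induction with
    | ind a ih =>
      intro ha
      by_contra! hia
      obtain ⟨ρ₀, h1, h2, h3, l, h4, h5⟩ := H.exists_facet a i hia η ha (p3.trans p1)
      have hli := ih l h4 (h1.trans h5)
      obtain ⟨b, hb, hbl, hb'⟩ := c1 ρ₀ (mem_star.2 ⟨⟨a, h3⟩, h2, h1⟩) l hli h5
      exact hbl (H.not_branching ρ₀ h2 a b l h3 hb' h5 (hb.trans_lt hia).ne' h4.ne')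
  intro ρ'' h a ha
  have := c2 a ((mem_star.1 h).2.2.trans ha)
  exact ⟨this, c1 ρ'' h a this ha⟩

/-! ### Potentials modulo two on the dual graph -/

section Sums
variable {M : Type*} [AddCommGroup M]

lemma sum_cofaces (g : Fin (k + 1) → M) {ρ : Finset ι} (hρ : ρ.card = m + 1) {a b : Fin (k + 1)}
    (hab : a ≠ b) (ha : ρ ⊆ σ a) (hb : ρ ⊆ σ b) :
    ∑ i with ρ ⊆ σ i, g i = g a + g b := by
  have : Finset.univ.filter (fun i => ρ ⊆ σ i) = {a, b} := by
    ext i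
    simp only [Finset.mem_filter, Finset.mem_univ, true_and, Finset.mem_insert,
      Finset.mem_singleton]
    constructor
    · intro hi
      by_contra! h
      exact h.2 (H.not_branching ρ hρ a i b ha hi hb h.1.symm hab)
    · rintro (rfl | rfl) <;> assumption
  rw [this, Finset.sum_pair hab]

variable [Module (ZMod 2) M]

/-- Coboundaries sum to zero around `η`: exchanging the sums, each term through `η` is counted once
for each of its two facets through `η`. -/
lemma sum_star_sum_cofaces {η : Finset ι} (hη : η.card = m) (g : Fin (k + 1) → M) :
    ∑ ρ ∈ star m σ η, ∑ i with ρ ⊆ σ i, g i = 0 := by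
  rw [Finset.sum_comm' (t' := Finset.univ) (s' := fun i => cofacets m η (σ i))]
  · refine Finset.sum_eq_zero fun i _ => ?_
    rw [Finset.sum_const]
    by_cases h : η ⊆ σ i
    · rw [cofacets_card hη (H.card_eq i) h, two_nsmul, ZModModule.add_self]
    · have : cofacets m η (σ i) = ∅ := Finset.eq_empty_of_forall_notMem fun ρ hρ => by
        obtain ⟨h1, -, h2⟩ := mem_cofacets.1 hρ
        exact h (h2.trans h1)
      simp [this]
  · intro ρ i
    simp only [mem_star, Finset.mem_filter, Finset.mem_univ, true_and, mem_cofacets, and_true]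
    exact ⟨fun h => ⟨h.2, h.1.2⟩, fun h => ⟨⟨⟨i, h.1⟩, h.2⟩, h.1⟩⟩

/-- A function on the facets whose sum on every closed star vanishes is a coboundary. -/
lemma exists_potential (z : Finset ι → M)
    (hz : ∀ η : Finset ι, η.card = m →
      (∀ ρ ∈ star m σ η, ∃ a b, a ≠ b ∧ ρ ⊆ σ a ∧ ρ ⊆ σ b) → ∑ ρ ∈ star m σ η, z ρ = 0) :
    ∃ h : Fin (k + 1) → M, ∀ i j, i ≠ j → ∀ ρ : Finset ι, ρ.card = m + 1 → ρ ⊆ σ i → ρ ⊆ σ j →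
      z ρ = h i + h j := by
  have main : ∀ t ≤ k + 1, ∃ h : Fin (k + 1) → M, ∀ i j : Fin (k + 1), i.1 < t → j.1 < t → i ≠ j →
      ∀ ρ : Finset ι, ρ.card = m + 1 → ρ ⊆ σ i → ρ ⊆ σ j → z ρ = h i + h j := by
    intro t ht
    induction t with
    | zero => exact ⟨0, fun i j hi => absurd hi (by omega)⟩
    | succ t ih =>
      obtain ⟨h, hh⟩ := ih (by omega)
      let i : Fin (k + 1) := ⟨t, by omega⟩
      -- It remains to choose the value at `i`: all facets shared with earlier terms must prescribe
      -- the same one.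
      suffices hc : ∃ c : M, ∀ j < i, ∀ ρ : Finset ι, ρ.card = m + 1 → ρ ⊆ σ i → ρ ⊆ σ j →
          z ρ = c + h j by
        obtain ⟨c, hc⟩ := hc
        refine ⟨Function.update h i c, fun a b ha hb hab ρ hρ hρa hρb => ?_⟩
        by_cases hai : a = i
        · subst hai
          rw [Function.update_self, Function.update_of_ne hab.symm]
          exact hc b (lt_of_le_of_ne (Fin.le_def.2 (Nat.lt_succ_iff.1 hb)) hab.symm) ρ hρ hρa hρb
        · by_cases hbi : b = i
          · subst hbi
            rw [Function.update_self, Function.update_of_ne hab, add_comm]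
            exact hc a (lt_of_le_of_ne (Fin.le_def.2 (Nat.lt_succ_iff.1 ha)) hab) ρ hρ hρb hρa
          · rw [Function.update_of_ne hai, Function.update_of_ne hbi]
            refine hh a b ?_ ?_ hab ρ hρ hρa hρb
            · exact lt_of_le_of_ne (Nat.lt_succ_iff.1 ha) fun h => hai (Fin.ext h)
            · exact lt_of_le_of_ne (Nat.lt_succ_iff.1 hb) fun h => hbi (Fin.ext h)
      by_cases hex : ∃ j < i, ∃ ρ : Finset ι, ρ.card = m + 1 ∧ ρ ⊆ σ i ∧ ρ ⊆ σ j
      swap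
      · exact ⟨0, fun j hj ρ h1 h2 h3 => absurd ⟨j, hj, ρ, h1, h2, h3⟩ hex⟩
      obtain ⟨j₀, hj₀, ρ₀, p1, p2, p3⟩ := hex
      refine ⟨z ρ₀ + h j₀, fun j hj ρ q1 q2 q3 => ?_⟩
      by_cases hρ : ρ = ρ₀
      · subst hρ
        rw [H.not_branching ρ q1 i j j₀ q2 q3 p3 hj.ne' hj₀.ne', add_assoc, ZModModule.add_self,
          add_zero]
      -- Two distinct facets of one simplex meet in a codimension two face.
      have hη : (ρ ∩ ρ₀).card = m := by
        have h1 := Finset.card_union_add_card_inter ρ ρ₀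
        have h2 : (ρ ∪ ρ₀).card ≤ m + 2 :=
          (H.card_eq i) ▸ Finset.card_le_card (Finset.union_subset q2 p2)
        have h3 : m + 1 < (ρ ∪ ρ₀).card := by
          rw [← q1]
          refine Finset.card_lt_card (Finset.ssubset_iff_subset_ne.2
            ⟨Finset.subset_union_left, fun he => hρ ?_⟩)
          exact (Finset.eq_of_subset_of_card_le (Finset.union_eq_left.1 he.symm)
            (by omega)).symm
        omega
      have m1 : ρ ∈ cofacets m (ρ ∩ ρ₀) (σ i) := mem_cofacets.2 ⟨q2, q1, Finset.inter_subset_left⟩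
      have m2 : ρ₀ ∈ cofacets m (ρ ∩ ρ₀) (σ i) := mem_cofacets.2 ⟨p2, p1, Finset.inter_subset_right⟩
      have e2 : {ρ, ρ₀} = cofacets m (ρ ∩ ρ₀) (σ i) := by
        refine Finset.eq_of_subset_of_card_le (fun x hx => ?_) ?_
        · rcases Finset.mem_insert.1 hx with rfl | hx
          · exact m1
          · rwa [Finset.mem_singleton.1 hx]
        · rw [Finset.card_pair hρ, cofacets_card hη (H.card_eq i)
            (Finset.inter_subset_left.trans q2)]
      have hcl := H.star_closed hη m1 m2 hρ hj q3 hj₀ p3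
      have hz0 := hz _ hη fun x hx => by
        obtain ⟨a, ha⟩ := (mem_star.1 hx).1
        obtain ⟨-, b, -, hba, hb⟩ := hcl x hx a ha
        exact ⟨a, b, hba.symm, ha, hb⟩
      -- The induction hypothesis says nothing about `h i`; it is replaced by zero.
      let g : Fin (k + 1) → M := fun a => if a = i then 0 else h a
      have hs := H.sum_star_sum_cofaces hη g
      -- Every facet of the closed star other than `ρ` and `ρ₀` has both its cofaces before `i`,
      -- where `z` already equals the coboundary of `h`, so its contribution cancels.
      have hsum : ∑ x ∈ star m σ (ρ ∩ ρ₀), (z x + ∑ a with x ⊆ σ a, g a) =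
          (z ρ + h j) + (z ρ₀ + h j₀) := by
        rw [Finset.sum_eq_add_of_mem ρ ρ₀ (mem_star.2 ⟨⟨i, q2⟩, (mem_cofacets.1 m1).2⟩)
          (mem_star.2 ⟨⟨i, p2⟩, (mem_cofacets.1 m2).2⟩) hρ]
        · rw [H.sum_cofaces g q1 hj.ne q3 q2, H.sum_cofaces g p1 hj₀.ne p3 p2]
          simp [g, hj.ne, hj₀.ne]
        · rintro x hx ⟨hx1, hx2⟩
          obtain ⟨⟨a, ha⟩, hxc, hxη⟩ := mem_star.1 hx
          obtain ⟨hai, b, hbi, hba, hb⟩ := hcl x hx a ha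
          have hxi : ∀ c, x ⊆ σ c → c ≠ i := by
            rintro c hc rfl
            have : x ∈ ({ρ, ρ₀} : Finset (Finset ι)) := e2 ▸ mem_cofacets.2 ⟨hc, hxc, hxη⟩
            simp [hx1, hx2] at this
          have hai' := lt_of_le_of_ne hai (hxi a ha)
          have hbi' := lt_of_le_of_ne hbi (hxi b hb)
          rw [H.sum_cofaces g hxc hba.symm ha hb, hh a b hai' hbi' hba.symm x hxc ha hb]
          simp only [g, if_neg hai'.ne, if_neg hbi'.ne]
          exact ZModModule.add_self _
      rw [Finset.sum_add_distrib, hz0, hs, add_zero] at hsum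
      rw [← ZModModule.sub_eq_add (z ρ + h j), eq_comm, sub_eq_zero] at hsum
      rw [← hsum, add_assoc, ZModModule.add_self, add_zero]
  obtain ⟨h, hh⟩ := main (k + 1) le_rfl
  exact ⟨h, fun i j => hh i j i.2 j.2⟩

end Sums
end ShelledPseudomanifold
end Combinatorics

/-! ### Homology classes in terms of elements -/

section Cycles
variable {R : Type*} [Ring R] {C D : ChainComplex (ModuleCat.{u} R) ℕ}

lemma exists_homologyπ_eq {i : ℕ} (x : C.homology i) : ∃ z, (C.homologyπ i).hom z = x :=
  (ModuleCat.epi_iff_surjective _).1 inferInstance x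

lemma iCycles_injective (i : ℕ) : Function.Injective (C.iCycles i).hom :=
  (ModuleCat.mono_iff_injective _).1 inferInstance

lemma d_iCycles (i j : ℕ) (z : C.cycles i) : (C.d i j).hom ((C.iCycles i).hom z) = 0 :=
  congrArg (fun f => f.hom z) (C.iCycles_d i j)

lemma exists_iCycles_eq {i j : ℕ} (hij : (ComplexShape.down ℕ).Rel i j) {y : C.X i}
    (hy : (C.d i j).hom y = 0) : ∃ z, (C.iCycles i).hom z = y := by
  have h0 : ModuleCat.ofHom (LinearMap.ker (C.d i j).hom).subtype ≫ C.d i j = 0 := by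
    ext w : 2
    exact w.2
  refine ⟨(C.liftCycles' _ j hij h0).hom ⟨y, hy⟩, ?_⟩
  exact congrArg (fun f => f.hom ⟨y, hy⟩) (C.liftCycles_i _ j _ h0)

lemma iCycles_cyclesMap (φ : C ⟶ D) (i : ℕ) (z : C.cycles i) :
    (D.iCycles i).hom ((HomologicalComplex.cyclesMap φ i).hom z) =
      (φ.f i).hom ((C.iCycles i).hom z) :=
  congrArg (fun f => f.hom z) (HomologicalComplex.cyclesMap_i φ i)

lemma homologyMap_homologyπ (φ : C ⟶ D) (i : ℕ) (z : C.cycles i) :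
    (HomologicalComplex.homologyMap φ i).hom ((C.homologyπ i).hom z) =
      (D.homologyπ i).hom ((HomologicalComplex.cyclesMap φ i).hom z) :=
  congrArg (fun f => f.hom z) (HomologicalComplex.homologyπ_naturality φ i)

end Cycles

/-! ### Linear forms modulo two, and primitive complexes as shelled pseudomanifolds -/

section Lattice
variable {Λ : Type u} [AddCommGroup Λ]

/-- A linear form on the reduction modulo two is determined by its values on reductions. -/
lemma modTwo_hom_ext {f g : Dual (ZMod 2) (ModTwo Λ)} (h : ∀ x : Λ, f (red x) = g (red x)) :
    f = g := by
  have : f ∘ₗ (modTwoEquiv Λ).symm.toLinearMap = g ∘ₗ (modTwoEquiv Λ).symm.toLinearMap := by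
    refine LinearMap.ext fun y => ?_
    induction y using TensorProduct.induction_on with
    | zero => simp
    | add x y hx hy => rw [map_add, map_add, hx, hy]
    | tmul a x =>
      have e : a ⊗ₜ[ℤ] x = a • ((1 : ZMod 2) ⊗ₜ[ℤ] x) := by
        rw [TensorProduct.smul_tmul', smul_eq_mul, mul_one]
      rw [e, map_smul, map_smul]
      exact congrArg (a • ·) (h x)
  exact LinearMap.ext fun y => LinearMap.congr_fun this (modTwoEquiv Λ y)

variable [Module.Free ℤ Λ] [Module.Finite ℤ Λ]

/-- A linear form modulo two is determined by its values on the edges of a primitive simplex. -/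
lemma IsPrimitiveSimplex.modTwo_hom_ext {s : Finset Λ} (hs : IsPrimitiveSimplex s) {r : Λ}
    (hr : r ∈ s) {f g : Dual (ZMod 2) (ModTwo Λ)}
    (h : ∀ c ∈ s, f (red (c - r)) = g (red (c - r))) : f = g := by
  refine TropicalShelling.modTwo_hom_ext fun x => ?_
  let φ : Dual (ZMod 2) (ModTwo Λ) → Λ →ₗ[ℤ] ZMod 2 := fun f =>
    (f.toAddMonoidHom.comp red).toIntLinearMap
  exact LinearMap.congr_fun (ext_of_basis hs hr (φ f) (φ g) h) x

namespace PrimitiveComplex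
variable (K : PrimitiveComplex Λ)

lemma maximal_iff {s : Finset Λ} :
    Maximal (· ∈ K.faces) s ↔ s ∈ K.faces ∧ s.card = finrank ℤ Λ + 1 := by
  constructor
  · intro h
    obtain ⟨t, ht, hst, hc⟩ := K.pure s h.1
    obtain rfl : s = t := Finset.Subset.antisymm hst (h.2 ht hst)
    exact ⟨ht, hc⟩
  · rintro ⟨hs, hc⟩
    refine ⟨hs, fun t ht hst => ?_⟩
    obtain ⟨t', ht', htt', hc'⟩ := K.pure t ht
    have hst' : s ⊆ t' := Finset.Subset.trans hst htt'
    have : s = t' := Finset.eq_of_subset_of_card_le hst' (by omega)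
    exact this ▸ htt'

variable {K} in
lemma mem_faces_of_subset {s t : Finset Λ} (ht : t ∈ K.faces) (hst : s ⊆ t) (hs : s.Nonempty) :
    s ∈ K.faces := (K.isRelLowerSet_faces ht).2 hst hs

/-- A shelling of a primitive complex, as a numbering of its maximal simplices. -/
structure TopShelling {k : ℕ} (σ : Fin (k + 1) → K.Face) : Prop where
  isTop : ∀ i, K.IsTop (σ i)
  exists_eq : ∀ τ, K.IsTop τ → ∃ i, σ i = τ
  injective : Function.Injective σ
  shelled : ShelledPseudomanifold (finrank ℤ Λ - 1) fun i => (σ i).1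

lemma exists_topShelling (hn : 1 ≤ finrank ℤ Λ)
    (hK : IsShellable K.toPreAbstractSimplicialComplex) :
    ∃ (k : ℕ) (σ : Fin (k + 1) → K.Face), K.TopShelling σ := by
  obtain ⟨k, σ, hinj, hrange, hG⟩ := hK
  have hmem : ∀ i, σ i ∈ K.faces ∧ (σ i).card = finrank ℤ Λ + 1 := fun i =>
    K.maximal_iff.1 (hrange.subset (Set.mem_range_self i))
  refine ⟨k, fun i => ⟨σ i, (hmem i).1⟩, fun i => (hmem i).2, fun τ hτ => ?_,
    fun i j h => hinj (congrArg Subtype.val h), fun i => ?_, ?_, ?_⟩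
  · obtain ⟨i, hi⟩ := hrange.superset (K.maximal_iff.2 ⟨τ.2, hτ⟩)
    exact ⟨i, Subtype.ext hi⟩
  · rw [(hmem i).2]; omega
  · intro ρ hρ a b c ha hb hc hab hac
    have hρf : ρ ∈ K.faces := mem_faces_of_subset (hmem a).1 ha (Finset.card_pos.1 (by omega))
    have := K.card_cofaces (ρ := ⟨ρ, hρf⟩) (τ₁ := ⟨_, (hmem a).1⟩) (τ₂ := ⟨_, (hmem b).1⟩)
      (τ₃ := ⟨_, (hmem c).1⟩) (by change ρ.card = _; omega) (hmem a).2 (hmem b).2 (hmem c).2 ha hb hc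
      (fun h => hab (hinj (congrArg Subtype.val h))) (fun h => hac (hinj (congrArg Subtype.val h)))
    exact hinj (congrArg Subtype.val this)
  · intro i j hji τ hτi hτj
    obtain ⟨G, ⟨ρ₀, hρ₀⟩, hGc, hGi⟩ := hG i (Fin.ne_zero_of_lt hji)
    have main : ∀ ρ ∈ G, ρ.card = finrank ℤ Λ - 1 + 1 ∧ ρ ⊆ σ i ∧ ∃ j' < i, ρ ⊆ σ j' := by
      intro ρ hρ
      have h1 := (hGc ρ hρ).2
      rw [(hmem i).2] at h1
      have h2 := (hGi ρ (Finset.card_pos.1 (by omega))).2 ⟨ρ, hρ, Finset.Subset.refl _⟩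
      exact ⟨by omega, h2⟩
    -- The shelling condition describes only nonempty common faces; for the empty one, any member of
    -- `G` will do.
    rcases τ.eq_empty_or_nonempty with rfl | hne
    · exact ⟨ρ₀, Finset.empty_subset _, main ρ₀ hρ₀⟩
    · obtain ⟨ρ, hρ, hτρ⟩ := (hGi τ hne).1 ⟨hτi, j, hji, hτj⟩
      exact ⟨ρ, hτρ, main ρ hρ⟩

/-- In dimension one, some vertex lies in only one edge. -/
lemma exists_free_vertex (hn : finrank ℤ Λ = 1) {τ : K.Face} (hτ : K.IsTop τ) :
    ∃ v : Λ, {v} ∈ K.faces ∧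
      ∀ a b : K.Face, K.IsTop a → K.IsTop b → v ∈ a.1 → v ∈ b.1 → a = b := by
  classical
  obtain ⟨p, hp, q, hq, hpq⟩ := Finset.one_lt_card.1 (show 1 < τ.1.card by rw [hτ]; omega)
  obtain ⟨f₀, -, -, hf₀, -⟩ := exists_coord (K.primitive _ τ.2 hτ) hp hq hpq
  have hfin : {v : Λ | {v} ∈ K.faces}.Finite :=
    K.finite_faces.preimage (Finset.singleton_injective.injOn)
  have hvert : ∀ (s : K.Face), ∀ v ∈ s.1, {v} ∈ K.faces := fun s v hv =>
    mem_faces_of_subset s.2 (Finset.singleton_subset_iff.2 hv) (Finset.singleton_nonempty v)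
  -- Take an end of the complex: a vertex maximizing a coordinate. Two edges at `v` would point in
  -- opposite directions by `opposite_side`, so maximality would force `f₀` to vanish on both, hence
  -- everywhere, against `f₀ (p - q) = 1`.
  obtain ⟨v, hv, hmax⟩ := Set.exists_max_image _ f₀ hfin ⟨p, hvert τ p hp⟩
  refine ⟨v, hv, fun a b ha hb hva hvb => ?_⟩
  by_contra hab
  have edge : ∀ s : K.Face, K.IsTop s → v ∈ s.1 → ∃ w, w ∉ ({v} : Finset Λ) ∧ insert w {v} = s.1 := by
    intro s hs hvs
    obtain ⟨w, hw⟩ := Finset.card_eq_one.1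
      (show (s.1.erase v).card = 1 by rw [Finset.card_erase_of_mem hvs, hs]; omega)
    have hw' : w ∈ s.1.erase v := by simp [hw]
    refine ⟨w, by simpa using (Finset.mem_erase.1 hw').1, ?_⟩
    rw [Finset.pair_comm, ← hw, Finset.insert_erase hvs]
  obtain ⟨w, hw, hwe⟩ := edge a ha hva
  obtain ⟨w', hw', hwe'⟩ := edge b hb hvb
  have hww : w ≠ w' := by
    rintro rfl
    exact hab (Subtype.ext (hwe.symm.trans hwe'))
  have fa : insert w {v} ∈ K.faces := hwe ▸ a.2
  have fb : insert w' {v} ∈ K.faces := hwe' ▸ b.2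
  have pa := K.primitive _ fa (by rw [hwe]; exact ha)
  have pb := K.primitive _ fb (by rw [hwe']; exact hb)
  have hvv := Finset.mem_singleton_self v
  obtain ⟨f, -, -, hf1, -⟩ := exists_coord pb (Finset.mem_insert_self w' {v})
    (Finset.mem_insert_of_mem hvv) (by simpa using hw')
  have hf0 : ∀ c ∈ ({v} : Finset Λ), f (c - v) = 0 := fun c hc => by
    rw [Finset.mem_singleton.1 hc, sub_self, map_zero]
  have e1 := K.opposite_side hvv hw hw' hww fa fb pa pb f hf1 hf0
  have e2 : f₀ = f₀ (w' - v) • f := by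
    apply ext_of_basis pb (Finset.mem_insert_of_mem hvv)
    intro c hc
    rcases Finset.mem_insert.1 hc with rfl | hc
    · simp [hf1]
    · rw [Finset.mem_singleton.1 hc]; simp
  have e3 : f₀ (w - v) = - f₀ (w' - v) := by
    conv_lhs => rw [e2]
    simp [e1]
  have h1 := hmax w (hvert a w (hwe ▸ Finset.mem_insert_self w {v}))
  have h2 := hmax w' (hvert b w' (hwe' ▸ Finset.mem_insert_self w' {v}))
  rw [map_sub, map_sub] at e3
  have h3 : f₀ (w' - v) = 0 := by rw [map_sub]; omega
  rw [h3, zero_smul] at e2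
  rw [e2] at hf₀
  simp at hf₀

variable {K} in
/-- An `n`-simplex as a relative cell. -/
def topCell (τ : K.Face) (h : K.IsTop τ) : Cell K.boundary (finrank ℤ Λ) :=
  ⟨τ, h, K.isTop_notMem_boundary h⟩

lemma notMem_boundary_of_two {ρ : K.Face} (hρ : ρ.1.card = finrank ℤ Λ) {τ₁ τ₂ : K.Face}
    (h₁ : K.IsTop τ₁) (h₂ : K.IsTop τ₂) (hne : τ₁ ≠ τ₂) (l₁ : ρ ≤ τ₁) (l₂ : ρ ≤ τ₂) :
    ρ ∉ K.boundary := by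
  rintro ⟨ρ', ⟨hρ', hu⟩, hle⟩
  obtain rfl : ρ = ρ' := Subtype.ext (Finset.eq_of_subset_of_card_le hle (by omega))
  exact hne (hu.unique ⟨h₁, l₁⟩ ⟨h₂, l₂⟩)

/-- By `card_cofaces` the boundary coefficient at an interior facet has only the two summands coming
from `τ₁` and `τ₂`. -/
lemma relBoundary_facet (F : Cosheaf K.toPreAbstractSimplicialComplex)
    (c : RelChain K.boundary F (finrank ℤ Λ)) (ρ : Cell K.boundary (finrank ℤ Λ - 1))
    (hρ : ρ.1.1.card = finrank ℤ Λ) {τ₁ τ₂ : K.Face}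
    (h₁ : K.IsTop τ₁) (h₂ : K.IsTop τ₂) (hne : τ₁ ≠ τ₂) (l₁ : ρ.1 ≤ τ₁) (l₂ : ρ.1 ≤ τ₂) :
    relBoundary K.boundary F (finrank ℤ Λ) (finrank ℤ Λ - 1) c ρ =
      (F.map (homOfLE l₁).op).hom (c (topCell τ₁ h₁)) +
        (F.map (homOfLE l₂).op).hom (c (topCell τ₂ h₂)) := by
  rw [relBoundary_apply]
  refine Fintype.sum_eq_add
    (⟨topCell τ₁ h₁, l₁⟩ : {τ : Cell K.boundary (finrank ℤ Λ) // ρ.1 ≤ τ.1}) ⟨topCell τ₂ h₂, l₂⟩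
    (fun h => hne (congrArg (fun t => t.1.1) h)) ?_
  rintro t ⟨ht1, ht2⟩
  exfalso
  refine ht2 (Subtype.ext (Subtype.ext ?_))
  exact K.card_cofaces hρ h₁ t.1.2.1 h₂ l₁ t.2 l₂
    (fun h => ht1 (Subtype.ext (Subtype.ext h.symm))) hne

namespace TopShelling
variable {K} {k : ℕ} {σ : Fin (k + 1) → K.Face} (S : K.TopShelling σ)
include S

lemma exists_pair {ρ : K.Face} (hρ : ρ.1.card = finrank ℤ Λ) (hb : ρ ∉ K.boundary) :
    ∃ i j, i ≠ j ∧ ρ ≤ σ i ∧ ρ ≤ σ j := by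
  obtain ⟨τ₁, hτ₁f, hl, hτ₁⟩ := K.pure _ ρ.2
  have hnot : ¬ ∃! τ : K.Face, K.IsTop τ ∧ ρ ≤ τ := fun h => hb (subset_lowerClosure ⟨hρ, h⟩)
  obtain ⟨τ₂, ⟨hτ₂, hl₂⟩, hne⟩ : ∃ τ : K.Face, (K.IsTop τ ∧ ρ ≤ τ) ∧ τ ≠ ⟨τ₁, hτ₁f⟩ := by
    by_contra! h
    exact hnot ⟨⟨τ₁, hτ₁f⟩, ⟨hτ₁, hl⟩, h⟩
  obtain ⟨i, hi⟩ := S.exists_eq ⟨τ₁, hτ₁f⟩ hτ₁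
  obtain ⟨j, rfl⟩ := S.exists_eq τ₂ hτ₂
  refine ⟨i, j, ?_, ?_, hl₂⟩
  · rintro rfl
    exact hne hi
  · rw [hi]; exact hl

variable [DecidableEq Λ]

/-- A codimension two face all of whose cofacets belong to two maximal simplices is not empty: this
is where the embedding is used in dimension one. -/
lemma nonempty_of_closed (hn : 1 ≤ finrank ℤ Λ) {η : Finset Λ} (hη : η.card = finrank ℤ Λ - 1)
    (hcl : ∀ ρ ∈ ShelledPseudomanifold.star (finrank ℤ Λ - 1) (fun i => (σ i).1) η,
      ∃ a b, a ≠ b ∧ ρ ⊆ (σ a).1 ∧ ρ ⊆ (σ b).1) : η.Nonempty := by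
  rw [Finset.nonempty_iff_ne_empty]
  rintro rfl
  rw [Finset.card_empty] at hη
  obtain ⟨v, hv, hu⟩ := K.exists_free_vertex (by omega) (S.isTop 0)
  obtain ⟨t, ht, hvt, htc⟩ := K.pure _ hv
  obtain ⟨i, hi⟩ := S.exists_eq ⟨t, ht⟩ htc
  obtain ⟨a, b, hab, ha, hb⟩ := hcl {v} (ShelledPseudomanifold.mem_star.2
    ⟨⟨i, by rw [hi]; exact hvt⟩, by rw [Finset.card_singleton]; omega, Finset.empty_subset _⟩)
  exact hab (S.injective (hu _ _ (S.isTop a) (S.isTop b) (Finset.singleton_subset_iff.1 ha)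
    (Finset.singleton_subset_iff.1 hb)))

/-- Ensures that `η` is a relative cell, so that the cycle condition is available at `η`. A face of
∂K lies in a facet with a single coface, and that facet belongs to its star. -/
lemma notMem_boundary_of_closed (hn : 1 ≤ finrank ℤ Λ) {η : K.Face}
    (hcl : ∀ ρ ∈ ShelledPseudomanifold.star (finrank ℤ Λ - 1) (fun i => (σ i).1) η.1,
      ∃ a b, a ≠ b ∧ ρ ⊆ (σ a).1 ∧ ρ ⊆ (σ b).1) : η ∉ K.boundary := by
  rintro ⟨ρ, ⟨hρ, hu⟩, hle⟩
  obtain ⟨τ, hτ, hρτ⟩ := hu.exists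
  obtain ⟨i, rfl⟩ := S.exists_eq τ hτ
  obtain ⟨a, b, hab, ha, hb⟩ := hcl ρ.1
    (ShelledPseudomanifold.mem_star.2 ⟨⟨i, hρτ⟩, by omega, hle⟩)
  exact hab (S.injective (hu.unique ⟨S.isTop a, ha⟩ ⟨S.isTop b, hb⟩))

end TopShelling

/-- The constant cosheaf with value `t(𝔽₂)`. -/
noncomputable abbrev ambientCosheaf : Cosheaf K.toPreAbstractSimplicialComplex :=
  constantCosheaf K.toPreAbstractSimplicialComplex (ModTwo Λ)

lemma derivativeChain_topCell (ε : K.SignDistribution) (τ : K.Face) (h : K.IsTop τ) :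
    K.derivativeChain ε (topCell τ h) = K.derivativeAt τ h ε := rfl

/-! ### Chain-level computations: constant coefficients and integration of cotangent cycles -/

namespace TopShelling
variable {K} {k : ℕ} {σ : Fin (k + 1) → K.Face} (S : K.TopShelling σ)
include S

/-- The group `H_{n-1}(K, ∂K; t(𝔽₂))` vanishes. -/
lemma exists_chain_of_ambient_cycle (hn : 1 ≤ finrank ℤ Λ)
    (z : RelChain K.boundary K.ambientCosheaf (finrank ℤ Λ - 1))
    (hz : ∀ j, j + 1 = finrank ℤ Λ - 1 →
      relBoundary K.boundary K.ambientCosheaf (finrank ℤ Λ - 1) j z = 0) :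
    ∃ h, relBoundary K.boundary K.ambientCosheaf (finrank ℤ Λ) (finrank ℤ Λ - 1) h = z := by
  classical
  let M := Dual (ZMod 2) (ModTwo Λ)
  -- The relative chain, extended by zero to all finite sets.
  let z' : Finset Λ → M := fun ρ => if h : ∃ c : Cell K.boundary (finrank ℤ Λ - 1), c.1.1 = ρ then
    z h.choose else 0
  have hz' : ∀ c : Cell K.boundary (finrank ℤ Λ - 1), z' c.1.1 = z c := by
    intro c
    have h : ∃ c' : Cell K.boundary (finrank ℤ Λ - 1), c'.1.1 = c.1.1 := ⟨c, rfl⟩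
    have h' : h.choose = c := Subtype.ext (Subtype.ext h.choose_spec)
    exact (dif_pos h).trans (congrArg (fun c => (z c : M)) h')
  obtain ⟨h, hh⟩ := S.shelled.exists_potential z' fun η hη hcl => by
    have hne := S.nonempty_of_closed hn hη hcl
    by_cases hηf : η ∈ K.faces
    swap
    · refine Finset.sum_eq_zero fun ρ hρ => ?_
      obtain ⟨⟨i, hi⟩, -, hηρ⟩ := ShelledPseudomanifold.mem_star.1 hρ
      exact absurd (mem_faces_of_subset (σ i).2 (Finset.Subset.trans hηρ hi) hne) hηf
    obtain ⟨j, hj⟩ : ∃ j, j + 1 = finrank ℤ Λ - 1 :=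
      ⟨finrank ℤ Λ - 1 - 1, by have := Finset.card_pos.2 hne; omega⟩
    let e : Cell K.boundary j :=
      ⟨⟨η, hηf⟩, by rw [hη]; exact hj.symm, S.notMem_boundary_of_closed hn hcl⟩
    have h0 := congrFun (hz j hj) e
    rw [relBoundary_apply] at h0
    refine Eq.trans ?_ h0
    symm
    -- All facets of a closed star are interior, so the sum over the star is the boundary
    -- coefficient of `z` at `η`.
    refine Finset.sum_bij (fun c _ => c.1.1.1) ?_ ?_ ?_ ?_
    · intro c _
      obtain ⟨t, ht, hct, htc⟩ := K.pure _ c.1.1.2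
      obtain ⟨i, hi⟩ := S.exists_eq ⟨t, ht⟩ htc
      exact ShelledPseudomanifold.mem_star.2 ⟨⟨i, by rw [hi]; exact hct⟩, c.1.2.1, c.2⟩
    · intro c _ c' _ h
      exact Subtype.ext (Subtype.ext (Subtype.ext h))
    · intro ρ hρ
      obtain ⟨a, b, hab, ha, hb⟩ := hcl ρ hρ
      obtain ⟨-, hc, hηρ⟩ := ShelledPseudomanifold.mem_star.1 hρ
      refine ⟨⟨⟨⟨ρ, mem_faces_of_subset (σ a).2 ha (Finset.card_pos.1 (by omega))⟩, hc, ?_⟩, hηρ⟩,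
        Finset.mem_univ _, rfl⟩
      exact K.notMem_boundary_of_two (by change ρ.card = _; omega) (S.isTop a) (S.isTop b)
        (S.injective.ne hab) ha hb
    · intro c _
      exact (hz' c.1).symm
  choose ind hind using S.exists_eq
  refine ⟨fun τ => h (ind τ.1 τ.2.1), funext fun ρ => ?_⟩
  have hρ : ρ.1.1.card = finrank ℤ Λ := by rw [ρ.2.1]; omega
  obtain ⟨i, j, hij, hi, hj⟩ := S.exists_pair hρ ρ.2.2
  refine (K.relBoundary_facet K.ambientCosheaf _ ρ hρ (S.isTop i) (S.isTop j) (S.injective.ne hij)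
    hi hj).trans ?_
  have hi' : ind (σ i) (S.isTop i) = i := S.injective (hind _ _)
  have hj' : ind (σ j) (S.isTop j) = j := S.injective (hind _ _)
  change h (ind (σ i) (S.isTop i)) + h (ind (σ j) (S.isTop j)) = (z ρ : M)
  rw [hi', hj', ← hz' ρ]
  exact (hh i j hij ρ.1.1 (by omega) hi hj).symm

/-- At an interior facet the cycle condition says that the two adjacent coefficients are equal
modulo 2; connectedness of the dual graph does the rest. -/
lemma ambient_cycle_constant (hn : 1 ≤ finrank ℤ Λ)
    (y : RelChain K.boundary K.ambientCosheaf (finrank ℤ Λ))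
    (hy : relBoundary K.boundary K.ambientCosheaf (finrank ℤ Λ) (finrank ℤ Λ - 1) y = 0) :
    ∃ v : Dual (ZMod 2) (ModTwo Λ), ∀ τ, y τ = v := by
  let h : Fin (k + 1) → Dual (ZMod 2) (ModTwo Λ) := fun i => y (topCell (σ i) (S.isTop i))
  refine ⟨h 0, fun τ => ?_⟩
  obtain ⟨i, hi⟩ := S.exists_eq τ.1 τ.2.1
  obtain rfl : topCell (σ i) (S.isTop i) = τ := Subtype.ext hi
  refine S.shelled.eq_of_adjacent h (fun i j hij ρ hρ hi hj => ?_) i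
  have hρ' : ρ.card = finrank ℤ Λ := by omega
  let r : Cell K.boundary (finrank ℤ Λ - 1) :=
    ⟨⟨ρ, mem_faces_of_subset (σ i).2 hi (Finset.card_pos.1 (by omega))⟩, hρ,
      K.notMem_boundary_of_two hρ' (S.isTop i) (S.isTop j) (S.injective.ne hij) hi hj⟩
  have h0 : h i + h j = 0 := (K.relBoundary_facet K.ambientCosheaf y r hρ' (S.isTop i) (S.isTop j)
    (S.injective.ne hij) hi hj).symm.trans (congrFun hy r)
  rwa [← ZModModule.sub_eq_add, sub_eq_zero] at h0

/-- Each coefficient integrates on its own simplex up to a constant. The potential adjusts these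
constants so that the local primitives agree on shared facets, and the shelling extends the
agreement to all shared vertices. -/
lemma exists_derivativeChain_eq (hn : 1 ≤ finrank ℤ Λ)
    (c : RelChain K.boundary K.cotangentCosheaf (finrank ℤ Λ))
    (hc : relBoundary K.boundary K.cotangentCosheaf (finrank ℤ Λ) (finrank ℤ Λ - 1) c = 0) :
    ∃ ε, K.derivativeChain ε = c := by
  classical
  have hE : ∀ i, ∃ E : Dual (ZMod 2) (ModTwo Λ),
      (tangentModTwo (σ i).1).dualRestrict E = c (topCell (σ i) (S.isTop i)) := fun i =>
    Subspace.dualRestrict_surjective _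
  choose E hE using hE
  let e : Fin (k + 1) → Λ → ZMod 2 := fun i v => E i (red v)
  have he : ∀ i v w, e i (w - v) = e i w - e i v := fun i v w => by simp only [e, map_sub]
  have hadj : ∀ i j, i ≠ j → ∀ ρ : Finset Λ, ρ.card = finrank ℤ Λ - 1 + 1 → ρ ⊆ (σ i).1 →
      ρ ⊆ (σ j).1 → ∀ v ∈ ρ, ∀ w ∈ ρ, e i v + e j v = e i w + e j w := by
    intro i j hij ρ hρ hi hj v hv w hw
    have hρ' : ρ.card = finrank ℤ Λ := by omega
    let r : Cell K.boundary (finrank ℤ Λ - 1) :=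
      ⟨⟨ρ, mem_faces_of_subset (σ i).2 hi ⟨v, hv⟩⟩, hρ,
        K.notMem_boundary_of_two hρ' (S.isTop i) (S.isTop j) (S.injective.ne hij) hi hj⟩
    have h0 := (K.relBoundary_facet K.cotangentCosheaf c r hρ' (S.isTop i) (S.isTop j)
      (S.injective.ne hij) hi hj).symm.trans (congrFun hc r)
    rw [← hE i, ← hE j] at h0
    have h1 : E i (red (w - v)) + E j (red (w - v)) = 0 :=
      LinearMap.congr_fun (show (_ : Dual (ZMod 2) (tangentModTwo ρ)) = 0 from h0)
        ⟨red (w - v), red_sub_mem hv hw⟩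
    change e i (w - v) + e j (w - v) = 0 at h1
    rw [he, he] at h1
    linear_combination -h1
  -- On an interior facet this is the constant value of `e i + e j`, read at a chosen vertex; `hzv`
  -- shows that the choice does not matter.
  let z : Finset Λ → ZMod 2 := fun ρ => if h : ρ.Nonempty then
    ∑ i with ρ ⊆ (σ i).1, e i h.choose else 0
  have hzv : ∀ ρ : Finset Λ, ρ.card = finrank ℤ Λ - 1 + 1 → ∀ i j, i ≠ j → ρ ⊆ (σ i).1 →
      ρ ⊆ (σ j).1 → ∀ v ∈ ρ, z ρ = ∑ i with ρ ⊆ (σ i).1, e i v := by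
    intro ρ hρ i j hij hi hj v hv
    have hne : ρ.Nonempty := ⟨v, hv⟩
    simp only [z, dif_pos hne]
    rw [S.shelled.sum_cofaces (fun i => e i hne.choose) hρ hij hi hj,
      S.shelled.sum_cofaces (fun i => e i v) hρ hij hi hj]
    exact hadj i j hij ρ hρ hi hj _ hne.choose_spec _ hv
  obtain ⟨h, hh⟩ := S.shelled.exists_potential z fun η hη hcl => by
    obtain ⟨v, hv⟩ := S.nonempty_of_closed hn hη hcl
    -- Reading every constant of the star at the same vertex `v` of `η` turns `z` into the
    -- coboundary of `i ↦ e i v`.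
    rw [← S.shelled.sum_star_sum_cofaces hη (fun i => e i v)]
    refine Finset.sum_congr rfl fun ρ hρ => ?_
    obtain ⟨a, b, hab, ha, hb⟩ := hcl ρ hρ
    obtain ⟨-, hρc, hηρ⟩ := ShelledPseudomanifold.mem_star.1 hρ
    exact hzv ρ hρc a b hab ha hb v (hηρ hv)
  have hglue : ∀ i j, j < i → ∀ v ∈ (σ i).1, v ∈ (σ j).1 → e i v + h i = e j v + h j := by
    intro i
    induction i using WellFoundedLT.induction with
    | ind i ih =>
      intro j hji v hvi hvj
      obtain ⟨ρ, hvρ, hρ, hρi, l, hli, hρl⟩ := S.shelled.exists_facet i j hji {v}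
        (Finset.singleton_subset_iff.2 hvi) (Finset.singleton_subset_iff.2 hvj)
      have hv := Finset.singleton_subset_iff.1 hvρ
      have e1 := hh i l hli.ne' ρ hρ hρi hρl
      rw [hzv ρ hρ i l hli.ne' hρi hρl v hv,
        S.shelled.sum_cofaces (fun i => e i v) hρ hli.ne' hρi hρl] at e1
      have e2 : e i v + h i = e l v + h l := by
        have e4 := CharTwo.add_self_eq_zero (e l v)
        have e5 := CharTwo.add_self_eq_zero (h i)
        linear_combination e1 - e4 + e5
      -- Through the facet `ρ` containing `v`, the comparison of `i` with `j` reduces to that of `l`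
      -- with `j`, both smaller than `i`.
      rcases lt_trichotomy l j with hlj | rfl | hlj
      · rw [e2, ih j hji l hlj v hvj (hρl hv)]
      · exact e2
      · rw [e2, ih l hli j hlj v (hρl hv) hvj]
  have hex : ∀ v : K.Vertex, ∃ i, v.1 ∈ (σ i).1 := fun v => by
    obtain ⟨t, ht, hvt, htc⟩ := K.pure _ v.2
    obtain ⟨i, hi⟩ := S.exists_eq ⟨t, ht⟩ htc
    exact ⟨i, by rw [hi]; exact Finset.singleton_subset_iff.1 hvt⟩
  choose ind hind using hex
  have hε : ∀ (v : K.Vertex) i, v.1 ∈ (σ i).1 → e (ind v) v.1 + h (ind v) = e i v.1 + h i := by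
    intro v i hi
    rcases lt_trichotomy (ind v) i with hlt | heq | hlt
    · exact (hglue _ _ hlt v.1 hi (hind v)).symm
    · rw [heq]
    · exact hglue _ _ hlt v.1 (hind v) hi
  refine ⟨fun v => e (ind v) v.1 + h (ind v), funext fun τ => ?_⟩
  obtain ⟨i, hi⟩ := S.exists_eq τ.1 τ.2.1
  obtain rfl : topCell (σ i) (S.isTop i) = τ := Subtype.ext hi
  symm
  rw [K.derivativeChain_topCell]
  refine (hE i).symm.trans (K.eq_derivativeAt (σ i) (S.isTop i) _
    ((tangentModTwo (σ i).1).dualRestrict (E i)) ?_)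
  funext α β
  change e i (β.1 - α.1) = _
  rw [hε (vertexOf (σ i) β) i β.2, hε (vertexOf (σ i) α) i α.2, he]
  change e i β.1 - e i α.1 = (e i β.1 + h i) - (e i α.1 + h i)
  ring

/-- Zero derivative means constant on each maximal simplex; adjacent simplices share a vertex, so
the constants agree along the connected dual graph. -/
lemma derivativeChain_eq_zero_iff (ε : K.SignDistribution) :
    K.derivativeChain ε = 0 ↔ ∃ c, K.constantDistribution c = ε := by
  constructor
  · intro h0
    have hconst : ∀ i (α β : (σ i).1), ε (vertexOf (σ i) α) = ε (vertexOf (σ i) β) := by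
      intro i α β
      have h1 : K.derivativeAt (σ i) (S.isTop i) ε = 0 := congrFun h0 (topCell (σ i) (S.isTop i))
      have h2 := congrFun (congrFun (K.derivativeAt_spec (σ i) (S.isTop i) ε) α) β
      rw [h1, map_zero] at h2
      exact (sub_eq_zero.1 h2.symm).symm
    have hne : ∀ i, (σ i).1.Nonempty := fun i => (K.isRelLowerSet_faces (σ i).2).1
    let h : Fin (k + 1) → ZMod 2 := fun i => ε (vertexOf (σ i) ⟨_, (hne i).choose_spec⟩)
    have hh : ∀ i (α : (σ i).1), ε (vertexOf (σ i) α) = h i := fun i α => hconst i _ _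
    refine ⟨h 0, funext fun v => ?_⟩
    obtain ⟨t, ht, hvt, htc⟩ := K.pure _ v.2
    obtain ⟨i, hi⟩ := S.exists_eq ⟨t, ht⟩ htc
    have hv : v.1 ∈ (σ i).1 := by rw [hi]; exact Finset.singleton_subset_iff.1 hvt
    refine Eq.trans ?_ (hh i ⟨v.1, hv⟩).symm
    refine (S.shelled.eq_of_adjacent h (fun i j _ ρ hρ hi hj => ?_) i).symm
    obtain ⟨w, hw⟩ := Finset.card_pos.1 (show 0 < ρ.card by omega)
    exact (hh i ⟨w, hi hw⟩).symm.trans (hh j ⟨w, hj hw⟩)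
  · rintro ⟨c, rfl⟩
    funext τ
    symm
    refine K.eq_derivativeAt τ.1 τ.2.1 _ _ ?_
    refine (map_zero (edgeEvaluation τ.1.1)).trans ?_
    funext α β
    exact (sub_self c).symm

end TopShelling

/-! ### From chains to homology classes -/

/-- There are no (n+1)-simplices, hence no nonzero boundaries in degree n: classes can be compared
as cycles. -/
lemma homologyπ_injective (F : Cosheaf K.toPreAbstractSimplicialComplex) :
    Function.Injective ((relComplex K.boundary F).homologyπ (finrank ℤ Λ)).hom := by
  have h0 : (relComplex K.boundary F).d (finrank ℤ Λ + 1) (finrank ℤ Λ) = 0 := by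
    ext c : 2
    have hempty : IsEmpty (Cell K.boundary (finrank ℤ Λ + 1)) := ⟨fun τ => by
      obtain ⟨t, -, hτt, ht⟩ := K.pure _ τ.1.2
      have := Finset.card_le_card hτt
      rw [τ.2.1] at this
      omega⟩
    have hc : c = 0 := funext fun τ => hempty.elim τ
    rw [hc, map_zero, map_zero]
  have := (relComplex K.boundary F).isIso_homologyπ (finrank ℤ Λ + 1) (finrank ℤ Λ) (by simp) h0
  exact (ModuleCat.mono_iff_injective _).1 inferInstance

/-- The cycle underlying the first derivative. -/
lemma exists_cycle_firstDerivative (hn : 1 ≤ finrank ℤ Λ) (ε : K.SignDistribution) :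
    ∃ z, ((relComplex K.boundary K.cotangentCosheaf).iCycles (finrank ℤ Λ)).hom z =
        K.derivativeChain ε ∧
      ((relComplex K.boundary K.cotangentCosheaf).homologyπ (finrank ℤ Λ)).hom z =
        K.firstDerivative hn ε := by
  refine ⟨_, ?_, rfl⟩
  exact congrArg (fun f => f.hom ε) ((relComplex K.boundary K.cotangentCosheaf).liftCycles_i
    (ModuleCat.ofHom K.derivativeChain) (finrank ℤ Λ - 1) _ _)

lemma homologyπ_eq_firstDerivative (hn : 1 ≤ finrank ℤ Λ) (ε : K.SignDistribution)
    (z : (relComplex K.boundary K.cotangentCosheaf).cycles (finrank ℤ Λ))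
    (hz : ((relComplex K.boundary K.cotangentCosheaf).iCycles (finrank ℤ Λ)).hom z =
      K.derivativeChain ε) :
    ((relComplex K.boundary K.cotangentCosheaf).homologyπ (finrank ℤ Λ)).hom z =
      K.firstDerivative hn ε := by
  obtain ⟨z', h1, h2⟩ := K.exists_cycle_firstDerivative hn ε
  rw [← h2, iCycles_injective _ (hz.trans h1.symm)]

lemma firstDerivative_eq_zero_iff (hn : 1 ≤ finrank ℤ Λ) (ε : K.SignDistribution) :
    K.firstDerivative hn ε = 0 ↔ K.derivativeChain ε = 0 := by
  obtain ⟨z, h1, h2⟩ := K.exists_cycle_firstDerivative hn ε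
  constructor
  · intro h
    rw [← h2] at h
    have hz : z = 0 := K.homologyπ_injective _ (h.trans (map_zero _).symm)
    rw [← h1, hz]
    exact map_zero _
  · intro h
    rw [h] at h1
    have hz : z = 0 := iCycles_injective _ (h1.trans (map_zero _).symm)
    rw [← h2, hz]
    exact map_zero _

lemma derivativeChain_affineDistribution (f : ModTwo Λ →ᵃ[ZMod 2] ZMod 2) (τ : K.Face)
    (h : K.IsTop τ) : K.derivativeChain (K.affineDistribution f) (topCell τ h) =
      (tangentModTwo τ.1).dualRestrict f.linear := by
  rw [K.derivativeChain_topCell]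
  refine (K.eq_derivativeAt τ h _ ((tangentModTwo τ.1).dualRestrict f.linear) ?_).symm
  funext α β
  change f.linear (red (β.1 - α.1)) = f (red β.1) - f (red α.1)
  rw [map_sub, ← vsub_eq_sub, f.linearMap_vsub, vsub_eq_sub]

/-- The vertices of a single primitive simplex reduce to an affine frame modulo 2, so they already
detect affine functions. -/
lemma affineDistribution_injective {τ : K.Face} (hτ : K.IsTop τ) :
    Function.Injective K.affineDistribution := by
  rw [← LinearMap.ker_eq_bot, LinearMap.ker_eq_bot']
  intro f hf
  obtain ⟨r, hr⟩ := (K.isRelLowerSet_faces τ.2).1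
  have hv : ∀ c ∈ τ.1, f (red c) = 0 := fun c hc => congrFun hf (vertexOf τ ⟨c, hc⟩)
  have hlin : f.linear = 0 := by
    refine (K.primitive _ τ.2 hτ).modTwo_hom_ext hr fun c hc => ?_
    rw [map_sub, ← vsub_eq_sub, f.linearMap_vsub, hv c hc, hv r hr]
    simp
  ext x
  have h1 := f.linearMap_vsub x (red r)
  rw [hlin, hv r hr] at h1
  simpa using h1.symm

/-- The image in `H_n(K, ∂K; T^*)` of a constant cycle is the derivative of an affine function. -/
lemma homologyMap_eq_firstDerivative (hn : 1 ≤ finrank ℤ Λ)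
    (z : (relComplex K.boundary K.ambientCosheaf).cycles (finrank ℤ Λ))
    (f : ModTwo Λ →ᵃ[ZMod 2] ZMod 2)
    (hz : ((relComplex K.boundary K.ambientCosheaf).iCycles (finrank ℤ Λ)).hom z =
      fun _ => f.linear) :
    (HomologicalComplex.homologyMap (relComplexMap K.boundary
      (restrictionToDual K.tangent K.tangent_mono)) (finrank ℤ Λ)).hom
        (((relComplex K.boundary K.ambientCosheaf).homologyπ (finrank ℤ Λ)).hom z) =
      K.firstDerivative hn (K.affineDistribution f) := by
  refine (homologyMap_homologyπ _ _ z).trans ?_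
  refine K.homologyπ_eq_firstDerivative hn _ _ ?_
  refine (iCycles_cyclesMap _ _ z).trans ?_
  rw [hz]
  funext τ
  exact (K.derivativeChain_affineDistribution f τ.1 τ.2.1).symm

/-! ### Surjectivity and exactness in homology -/

namespace TopShelling
variable {K} {k : ℕ} {σ : Fin (k + 1) → K.Face} (S : K.TopShelling σ)
include S

lemma firstDerivative_surjective (hn : 1 ≤ finrank ℤ Λ) :
    Function.Surjective (K.firstDerivative hn) := by
  intro x
  obtain ⟨z, rfl⟩ := exists_homologyπ_eq x
  have h0 := d_iCycles (finrank ℤ Λ) (finrank ℤ Λ - 1) z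
  rw [relComplex_d _ _ _ _ (Nat.sub_add_cancel hn)] at h0
  obtain ⟨ε, hε⟩ := S.exists_derivativeChain_eq hn _ h0
  exact ⟨ε, (K.homologyπ_eq_firstDerivative hn ε z hε.symm).symm⟩

/-- In the long exact sequence the next term is H_{n-1}(K, ∂K; t(𝔽₂)), which vanishes by
`exists_chain_of_ambient_cycle`. -/
lemma connecting_surjective (hn : 1 ≤ finrank ℤ Λ) : Function.Surjective (K.connecting hn) := by
  have hex : (relComplex K.boundary K.ambientCosheaf).ExactAt (finrank ℤ Λ - 1) := by
    rw [HomologicalComplex.exactAt_iff' _ (finrank ℤ Λ) (finrank ℤ Λ - 1) _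
      (by rw [ChainComplex.prev]; omega) rfl, ShortComplex.moduleCat_exact_iff]
    intro z hz
    -- For n = 1 no such `j` exists, and every chain of degree zero counts as a cycle.
    obtain ⟨h, hh⟩ := S.exists_chain_of_ambient_cycle hn z fun j hj => by
      have hnext : (ComplexShape.down ℕ).next (finrank ℤ Λ - 1) = j :=
        (ComplexShape.down ℕ).next_eq' hj
      change ((relComplex K.boundary K.ambientCosheaf).d (finrank ℤ Λ - 1)
        ((ComplexShape.down ℕ).next (finrank ℤ Λ - 1))).hom z = 0 at hz
      rw [hnext, relComplex_d _ _ _ _ hj] at hz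
      exact hz
    refine ⟨h, ?_⟩
    change ((relComplex K.boundary K.ambientCosheaf).d (finrank ℤ Λ) (finrank ℤ Λ - 1)).hom h = z
    rw [relComplex_d _ _ _ _ (Nat.sub_add_cancel hn)]
    exact hh
  have hzero := (HomologicalComplex.exactAt_iff_isZero_homology _ _).1 hex
  have hδ := K.normalSequence_shortExact.homology_exact₁ (finrank ℤ Λ) (finrank ℤ Λ - 1)
    (down_rel hn)
  rw [ShortComplex.moduleCat_exact_iff] at hδ
  intro x
  refine hδ x ?_
  have := ModuleCat.subsingleton_of_isZero hzero
  exact Subsingleton.elim _ _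

lemma exact_affineDistribution (hn : 1 ≤ finrank ℤ Λ) :
    Function.Exact K.affineDistribution (K.secondDerivative hn) := by
  have hex := K.normalSequence_shortExact.homology_exact₃ (finrank ℤ Λ) (finrank ℤ Λ - 1)
    (down_rel hn)
  rw [ShortComplex.ShortExact.moduleCat_exact_iff_function_exact] at hex
  intro ε
  constructor
  · intro h
    obtain ⟨w, hw⟩ := (hex (K.firstDerivative hn ε)).1 h
    obtain ⟨z, rfl⟩ := exists_homologyπ_eq w
    have h0 := d_iCycles (finrank ℤ Λ) (finrank ℤ Λ - 1) z
    erw [relComplex_d _ _ _ _ (Nat.sub_add_cancel hn)] at h0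
    obtain ⟨v, hv⟩ := S.ambient_cycle_constant hn _ h0
    have h1 := K.homologyMap_eq_firstDerivative hn z v.toAffineMap (funext hv)
    -- The constant cycle `v` supplies the linear part; what remains of `ε` has zero derivative, so
    -- it is the constant term.
    have h2 : K.firstDerivative hn (ε - K.affineDistribution v.toAffineMap) = 0 := by
      rw [map_sub, sub_eq_zero]
      exact hw.symm.trans h1
    rw [K.firstDerivative_eq_zero_iff, S.derivativeChain_eq_zero_iff] at h2
    obtain ⟨c, hc⟩ := h2
    refine ⟨v.toAffineMap + AffineMap.const _ _ c, ?_⟩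
    rw [map_add, eq_comm, ← sub_eq_iff_eq_add', ← hc]
    rfl
  · rintro ⟨f, rfl⟩
    refine (hex _).2 ?_
    -- A constant chain is a relative cycle, since each interior facet receives the same vector
    -- twice.
    have hy : ((relComplex K.boundary K.ambientCosheaf).d (finrank ℤ Λ) (finrank ℤ Λ - 1)).hom
        (fun _ => f.linear) = 0 := by
      rw [relComplex_d _ _ _ _ (Nat.sub_add_cancel hn)]
      funext ρ
      have hρ : ρ.1.1.card = finrank ℤ Λ := by rw [ρ.2.1]; omega
      obtain ⟨i, j, hij, hi, hj⟩ := S.exists_pair hρ ρ.2.2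
      refine (K.relBoundary_facet K.ambientCosheaf _ ρ hρ (S.isTop i) (S.isTop j)
        (S.injective.ne hij) hi hj).trans ?_
      exact ZModModule.add_self f.linear
    obtain ⟨z, hz⟩ := exists_iCycles_eq (down_rel hn) hy
    exact ⟨_, K.homologyMap_eq_firstDerivative hn z f hz⟩

end TopShelling
end PrimitiveComplex
end Lattice

end TropicalShelling

theorem mainTheorem9 {Λ : Type u} [AddCommGroup Λ] [Module.Free ℤ Λ] [Module.Finite ℤ Λ]
    (hn : 1 ≤ Module.finrank ℤ Λ) (K : TropicalShelling.PrimitiveComplex Λ)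
    (hK : TropicalShelling.IsShellable K.toPreAbstractSimplicialComplex) :
    -- both derivatives are surjective
    (Function.Surjective (K.firstDerivative hn) ∧ Function.Surjective (K.secondDerivative hn)) ∧
    -- `0 → 𝔽₂ → C^0(K; 𝔽₂) → H_n(K, ∂K; T^*) → 0` is exact
    (Function.Injective K.constantDistribution ∧
      Function.Exact K.constantDistribution (K.firstDerivative hn) ∧
      Function.Surjective (K.firstDerivative hn)) ∧
    -- `0 → Aff(t^*(𝔽₂)) → C^0(K; 𝔽₂) → H_{n-1}(K, ∂K; N) → 0` is exact
    (Function.Injective K.affineDistribution ∧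
      Function.Exact K.affineDistribution (K.secondDerivative hn) ∧
      Function.Surjective (K.secondDerivative hn)) := by
  obtain ⟨k, σ, S⟩ := K.exists_topShelling hn hK
  have h1 := S.firstDerivative_surjective hn
  have h2 : Function.Surjective (K.secondDerivative hn) := (S.connecting_surjective hn).comp h1
  refine ⟨⟨h1, h2⟩, ⟨fun a b h => ?_, fun ε => ?_, h1⟩,
    K.affineDistribution_injective (S.isTop 0), S.exact_affineDistribution hn, h2⟩
  · obtain ⟨v, hv⟩ := (K.isRelLowerSet_faces (σ 0).2).1
    exact congrFun h (TropicalShelling.PrimitiveComplex.vertexOf (σ 0) ⟨v, hv⟩)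
  · rw [K.firstDerivative_eq_zero_iff, S.derivativeChain_eq_zero_iff]
    rfl
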